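/- Let $(M,\phi,\xi,\eta,g)$ be a 3-dimensional contact metric manifold: $M$ is a smooth 3-manifold with a contact form $\eta$ (that is, $\eta\wedge d\eta\neq 0$ everywhere), a smooth $(1,1)$-tensor field $\phi$, a smooth vector field $\xi$ and a smooth Riemannian metric $g$ such that $$\phi^2X=-X+\eta(X)\xi,\quad \phi\xi=0,\quad \eta\circ\phi=0,\quad \eta(\xi)=1,$$ $$g(\phi X,\phi Y)=g(X,Y)-\eta(X)\eta(Y),\quad g(X,\xi)=\eta(X),\quad d\eta(X,Y)=g(X,\phi Y)$$ for all vector fields $X,Y$, where $2\,d\eta(X,Y)=X\eta(Y)-Y\eta(X)-\eta([X,Y])$. Let $\nabla$ be the Levi-Civita connection of $g$, $R(X,Y)Z=[\nabla_X,\nabla_Y]Z-\nabla_{[X,Y]}Z$ its curvature tensor, $\rho(X,Y)=\operatorname{tr}(Z\mapsto R(Z,X)Y)$ the Ricci tensor and $\tau$ its metric trace, the scalar curvature. Let $\rho^*(X,Y)=\tfrac12\operatorname{tr}(Z\mapsto R(X,\phi Y)\phi Z)$ be the $*$-Ricci tensor, and let the $*$-scalar curvature $\tau^*$ be the trace of the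 $(1,1)$-tensor field $Q^*$ defined by $g(Q^*X,Y)=\rho^*(X,Y)$. Let $h=\tfrac12 L_\xi\phi$. Then, at every point of $M$, $$\tau^*-\tau+4=2\operatorname{tr}h^2 .$$ Moreover, if $M$ is K-contact (that is, $\xi$ is a Killing vector field of $g$), then $M$ is Sasakian, that is, the almost complex structure $J$ on $M\times\mathbb R$ given by $JX=\phi X-\eta(X)\frac{\partial}{\partial t}$ for $X$ tangent to $M$ and $J\frac{\partial}{\partial t}=\xi$ is integrable (its Nijenhuis tensor vanishes). -/

import Mathlib

open Bundle Manifold NormedSpace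
open scoped ContDiff

noncomputable section

namespace ContactGeometry

section Riemannian

/-! ## Riemannian geometry

`M` is a smooth manifold modelled on the finite-dimensional real vector space `E`, and its tangent
bundle carries a smooth Riemannian metric, written `inner ℝ u v` for `u v : TangentSpace 𝓘(ℝ, E) x`.
Vector fields are dependent functions `X : (x : M) → TangentSpace 𝓘(ℝ, E) x`; the proposition
`MDiffAt (T% X) x` says that `X` is differentiable at `x`. -/

variable {E : Type*} [NormedAddCommGroup E] [NormedSpace ℝ E] [FiniteDimensional ℝ E]
  {M : Type*} [TopologicalSpace M] [ChartedSpace E M] [IsManifold 𝓘(ℝ, E) ∞ M]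
  [RiemannianBundle (fun x : M ↦ TangentSpace 𝓘(ℝ, E) x)]
  [IsContMDiffRiemannianBundle 𝓘(ℝ, E) ∞ E (fun x : M ↦ TangentSpace 𝓘(ℝ, E) x)]

instance instFiniteDimensionalTangentSpace (x : M) :
    FiniteDimensional ℝ (TangentSpace 𝓘(ℝ, E) x) :=
  inferInstanceAs (FiniteDimensional ℝ E)

/-- Half of the right-hand side of the Koszul formula
`2 g(∇_X Y, Z) = X g(Y, Z) + Y g(X, Z) - Z g(X, Y) + g([X, Y], Z) - g([X, Z], Y) - g([Y, Z], X)`. -/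
def koszul (X Y Z : (x : M) → TangentSpace 𝓘(ℝ, E) x) (x : M) : ℝ :=
  (mvfderiv 𝓘(ℝ, E) (fun y ↦ inner ℝ (Y y) (Z y)) x (X x)
    + mvfderiv 𝓘(ℝ, E) (fun y ↦ inner ℝ (X y) (Z y)) x (Y x)
    - mvfderiv 𝓘(ℝ, E) (fun y ↦ inner ℝ (X y) (Y y)) x (Z x)
    + inner ℝ (VectorField.mlieBracket 𝓘(ℝ, E) X Y x) (Z x)
    - inner ℝ (VectorField.mlieBracket 𝓘(ℝ, E) X Z x) (Y x)
    - inner ℝ (VectorField.mlieBracket 𝓘(ℝ, E) Y Z x) (X x)) / 2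

theorem mdifferentiableAt_inner {X Y : (x : M) → TangentSpace 𝓘(ℝ, E) x} {x : M}
    (hX : MDiffAt (T% X) x) (hY : MDiffAt (T% Y) x) :
    MDiffAt (fun y ↦ (inner ℝ (X y) (Y y) : ℝ)) x :=
  MDifferentiableAt.inner_bundle (IB := 𝓘(ℝ, E)) (F := E)
    (E := fun x : M ↦ TangentSpace 𝓘(ℝ, E) x) (b := fun y ↦ y) (v := X) (w := Y) hX hY

theorem tensorialAt_koszul_left {Y Z : (x : M) → TangentSpace 𝓘(ℝ, E) x} {x : M}
    (hY : MDiffAt (T% Y) x) (hZ : MDiffAt (T% Z) x) :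
    TensorialAt 𝓘(ℝ, E) E (koszul · Y Z x) x where
  smul {f X} hf hX := by
    have h1 := mvfderiv_fun_mul hf (mdifferentiableAt_inner hX hZ)
    have h2 := mvfderiv_fun_mul hf (mdifferentiableAt_inner hX hY)
    simp only [koszul, Pi.smul_apply', real_inner_smul_left, h1, h2,
      VectorField.mlieBracket_smul_left hf hX, smul_eq_mul, inner_add_left, inner_smul_right,
      add_apply, smul_apply, map_smul]
    simp only [real_inner_comm (Y x) (X x), real_inner_comm (Z x) (X x)]
    ring
  add {X X'} hX hX' := by
    have h1 := mvfderiv_fun_add (mdifferentiableAt_inner hX hZ) (mdifferentiableAt_inner hX' hZ)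
    have h2 := mvfderiv_fun_add (mdifferentiableAt_inner hX hY) (mdifferentiableAt_inner hX' hY)
    simp only [koszul, Pi.add_apply, inner_add_left, h1, h2,
      VectorField.mlieBracket_add_left hX hX', inner_add_right, map_add, add_apply]
    ring

theorem tensorialAt_koszul_right {X Y : (x : M) → TangentSpace 𝓘(ℝ, E) x} {x : M}
    (hX : MDiffAt (T% X) x) (hY : MDiffAt (T% Y) x) :
    TensorialAt 𝓘(ℝ, E) E (koszul X Y · x) x where
  smul {f Z} hf hZ := by
    have h1 := mvfderiv_fun_mul hf (mdifferentiableAt_inner hX hZ)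
    have h2 := mvfderiv_fun_mul hf (mdifferentiableAt_inner hY hZ)
    simp only [koszul, Pi.smul_apply', real_inner_smul_left, h1, h2,
      VectorField.mlieBracket_smul_right hf hZ, smul_eq_mul, inner_add_left, inner_smul_right,
      add_apply, smul_apply, map_smul]
    simp only [real_inner_comm (X x) (Z x), real_inner_comm (Y x) (Z x)]
    ring
  add {Z Z'} hZ hZ' := by
    have h1 := mvfderiv_fun_add (mdifferentiableAt_inner hX hZ) (mdifferentiableAt_inner hX hZ')
    have h2 := mvfderiv_fun_add (mdifferentiableAt_inner hY hZ) (mdifferentiableAt_inner hY hZ')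
    simp only [koszul, Pi.add_apply, inner_add_left, h1, h2,
      VectorField.mlieBracket_add_right hZ hZ', inner_add_right, map_add, add_apply]
    ring

theorem koszul_add {X Y Y' Z : (x : M) → TangentSpace 𝓘(ℝ, E) x} {x : M}
    (hX : MDiffAt (T% X) x) (hZ : MDiffAt (T% Z) x)
    (hY : MDiffAt (T% Y) x) (hY' : MDiffAt (T% Y') x) :
    koszul X (Y + Y') Z x = koszul X Y Z x + koszul X Y' Z x := by
  have h1 := mvfderiv_fun_add (mdifferentiableAt_inner hX hY) (mdifferentiableAt_inner hX hY')
  have h2 := mvfderiv_fun_add (mdifferentiableAt_inner hY hZ) (mdifferentiableAt_inner hY' hZ)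
  simp only [koszul, Pi.add_apply, inner_add_left, h1, h2, VectorField.mlieBracket_add_right hY hY',
    VectorField.mlieBracket_add_left hY hY', inner_add_right, map_add, add_apply]
  ring

theorem koszul_smul {X Y Z : (x : M) → TangentSpace 𝓘(ℝ, E) x} {x : M} {f : M → ℝ}
    (hX : MDiffAt (T% X) x) (hZ : MDiffAt (T% Z) x) (hY : MDiffAt (T% Y) x) (hf : MDiffAt f x) :
    koszul X (f • Y) Z x
      = f x * koszul X Y Z x + mvfderiv 𝓘(ℝ, E) f x (X x) * inner ℝ (Y x) (Z x) := by
  have h1 := mvfderiv_fun_mul hf (mdifferentiableAt_inner hX hY)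
  have h2 := mvfderiv_fun_mul hf (mdifferentiableAt_inner hY hZ)
  simp only [koszul, Pi.smul_apply', real_inner_smul_left, h1, h2,
    VectorField.mlieBracket_smul_right hf hY, VectorField.mlieBracket_smul_left hf hY, smul_eq_mul,
    inner_add_left, inner_smul_right, add_apply, smul_apply, map_smul]
  simp only [real_inner_comm (X x) (Y x)]
  ring

open Classical in
/-- For `Y` differentiable at `x`, the linear map `u ↦ ∇_u Y` of `T_x M` given by the Koszul
formula: `∇_u Y = ∑ i, koszul (u, Y, e i) • e i` for an orthonormal basis `e` of `T_x M`.
(The value at fields which are not differentiable at `x` is irrelevant.) -/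
def koszulDerivative (Y : (x : M) → TangentSpace 𝓘(ℝ, E) x) (x : M) :
    TangentSpace 𝓘(ℝ, E) x →L[ℝ] TangentSpace 𝓘(ℝ, E) x :=
  if hY : MDiffAt (T% Y) x then
    ∑ i, (TensorialAt.mkHom
        (koszul · Y (FiberBundle.extend E (stdOrthonormalBasis ℝ (TangentSpace 𝓘(ℝ, E) x) i)) x) x
        (tensorialAt_koszul_left hY (FiberBundle.mdifferentiableAt_extend ..))).smulRight
      (stdOrthonormalBasis ℝ (TangentSpace 𝓘(ℝ, E) x) i)
  else 0

theorem inner_koszulDerivative {X Y Z : (x : M) → TangentSpace 𝓘(ℝ, E) x} {x : M}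
    (hX : MDiffAt (T% X) x) (hZ : MDiffAt (T% Z) x) (hY : MDiffAt (T% Y) x) :
    inner ℝ (koszulDerivative Y x (X x)) (Z x) = koszul X Y Z x := by
  set b := stdOrthonormalBasis ℝ (TangentSpace 𝓘(ℝ, E) x)
  have h (i) := TensorialAt.mkHom_apply
    (tensorialAt_koszul_left hY (FiberBundle.mdifferentiableAt_extend 𝓘(ℝ, E) E (b i))) hX
  rw [koszulDerivative, dif_pos hY]
  simp only [sum_apply, ContinuousLinearMap.smulRight_apply, sum_inner, real_inner_smul_left]
  have hh := TensorialAt.mkHom_apply (tensorialAt_koszul_right hX hY) hZ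
  rw [← hh]
  nth_rw 2 [← b.sum_repr (Z x)]
  rw [map_sum]
  refine Finset.sum_congr rfl fun i _ ↦ ?_
  rw [h i, map_smul, TensorialAt.mkHom_apply_eq_extend, b.repr_apply_apply, smul_eq_mul, mul_comm]

theorem isCovariantDerivativeOn_koszulDerivative :
    IsCovariantDerivativeOn E (koszulDerivative (E := E) (M := M)) := by
  constructor
  · intro Y Y' x hY hY' _
    ext u
    refine ext_inner_right ℝ fun w ↦ ?_
    have hX := FiberBundle.mdifferentiableAt_extend 𝓘(ℝ, E) E u
    have hZ := FiberBundle.mdifferentiableAt_extend 𝓘(ℝ, E) E w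
    have h1 := inner_koszulDerivative hX hZ hY
    have h2 := inner_koszulDerivative hX hZ hY'
    have h3 := inner_koszulDerivative hX hZ (mdifferentiableAt_add_section hY hY')
    rw [koszul_add hX hZ hY hY', ← h1, ← h2] at h3
    simpa [inner_add_left] using h3
  · intro Y f x hY hf _
    ext u
    refine ext_inner_right ℝ fun w ↦ ?_
    have hX := FiberBundle.mdifferentiableAt_extend 𝓘(ℝ, E) E u
    have hZ := FiberBundle.mdifferentiableAt_extend 𝓘(ℝ, E) E w
    have h1 := inner_koszulDerivative hX hZ hY
    have h3 := inner_koszulDerivative hX hZ (hf.smul_section hY)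
    rw [koszul_smul hX hZ hY hf, ← h1] at h3
    simpa [inner_add_left, real_inner_smul_left] using h3

variable (E M) in
/-- The Levi-Civita connection of the Riemannian metric. As usual in Mathlib,
`leviCivita E M Y x u` is `∇_u Y` for `u : T_x M`. -/
def leviCivita : CovariantDerivative 𝓘(ℝ, E) E (TangentSpace 𝓘(ℝ, E) : M → Type _) :=
  ⟨koszulDerivative, isCovariantDerivativeOn_koszulDerivative⟩

theorem leviCivita_metric {X Y Z : (x : M) → TangentSpace 𝓘(ℝ, E) x} {x : M}
    (hX : MDiffAt (T% X) x) (hY : MDiffAt (T% Y) x) (hZ : MDiffAt (T% Z) x) :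
    mvfderiv 𝓘(ℝ, E) (fun y ↦ inner ℝ (Y y) (Z y)) x (X x)
      = inner ℝ (leviCivita E M Y x (X x)) (Z x) + inner ℝ (Y x) (leviCivita E M Z x (X x)) := by
  have h1 := inner_koszulDerivative hX hZ hY
  have h2 := inner_koszulDerivative hX hY hZ
  rw [real_inner_comm] at h2
  simp only [leviCivita]
  rw [h1, h2]
  simp only [koszul, VectorField.mlieBracket_swap_apply (V := Z) (W := Y), inner_neg_left,
    real_inner_comm (Y _) (Z _)]
  ring

theorem leviCivita_torsion : (leviCivita E M).torsion = 0 := by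
  rw [CovariantDerivative.torsion_eq_zero_iff]
  intro X Y x hX hY
  refine ext_inner_right ℝ fun w ↦ ?_
  have hZ := FiberBundle.mdifferentiableAt_extend 𝓘(ℝ, E) E w
  have h1 := inner_koszulDerivative hX hZ hY
  have h2 := inner_koszulDerivative hY hZ hX
  simp only [FiberBundle.extend_apply_self] at h1 h2
  simp only [leviCivita, inner_sub_left]
  rw [h1, h2]
  simp only [koszul, VectorField.mlieBracket_swap_apply (V := Y) (W := X), inner_neg_left,
    real_inner_comm (Y _) (X _), FiberBundle.extend_apply_self]
  ring

/-- `R(X, Y)Z = ∇_X ∇_Y Z - ∇_Y ∇_X Z - ∇_[X, Y] Z` for vector fields. -/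
def curvatureField (X Y Z : (x : M) → TangentSpace 𝓘(ℝ, E) x) (x : M) : TangentSpace 𝓘(ℝ, E) x :=
  leviCivita E M (fun y ↦ leviCivita E M Z y (Y y)) x (X x)
    - leviCivita E M (fun y ↦ leviCivita E M Z y (X y)) x (Y x)
    - leviCivita E M Z x (VectorField.mlieBracket 𝓘(ℝ, E) X Y x)

/-- The curvature tensor `R(u, v)w` at `x`, computed with any vector fields smooth near `x` which
extend `u`, `v`, `w`; here the extensions are `FiberBundle.extend`, which are constant in a
trivialization around `x`. -/
def curvature (x : M) (u v w : TangentSpace 𝓘(ℝ, E) x) : TangentSpace 𝓘(ℝ, E) x :=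
  curvatureField (FiberBundle.extend E u) (FiberBundle.extend E v) (FiberBundle.extend E w) x

/-- The trace of an endomorphism `A` of `T_x M`: `∑ i, g(A (e i), e i)`, `e` an orthonormal basis. -/
def tangentTrace (x : M) (A : TangentSpace 𝓘(ℝ, E) x → TangentSpace 𝓘(ℝ, E) x) : ℝ :=
  ∑ i, inner ℝ (A (stdOrthonormalBasis ℝ (TangentSpace 𝓘(ℝ, E) x) i))
    (stdOrthonormalBasis ℝ (TangentSpace 𝓘(ℝ, E) x) i)

/-- The endomorphism `Q` of `T_x M` corresponding to the bilinear form `B` by `g(Q u, v) = B(u, v)`,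
that is `Q u = ∑ i, B(u, e i) • e i` for an orthonormal basis `e`. -/
def raiseIndex (x : M) (B : TangentSpace 𝓘(ℝ, E) x → TangentSpace 𝓘(ℝ, E) x → ℝ)
    (u : TangentSpace 𝓘(ℝ, E) x) : TangentSpace 𝓘(ℝ, E) x :=
  ∑ i, B u (stdOrthonormalBasis ℝ (TangentSpace 𝓘(ℝ, E) x) i) •
    stdOrthonormalBasis ℝ (TangentSpace 𝓘(ℝ, E) x) i

/-- The Ricci tensor `ρ(u, v) = trace (w ↦ R(w, u)v)`. -/
def ricci (x : M) (u v : TangentSpace 𝓘(ℝ, E) x) : ℝ :=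
  tangentTrace x fun w ↦ curvature x w u v

variable (E) in
/-- The scalar curvature `τ`, the trace of the Ricci operator. -/
def scalarCurvature (x : M) : ℝ :=
  tangentTrace (E := E) x (raiseIndex x (ricci x))

end Riemannian

section Contact

/-! ## Contact metric structures -/

variable {E : Type*} [NormedAddCommGroup E] [NormedSpace ℝ E]
  {M : Type*} [TopologicalSpace M] [ChartedSpace E M] [IsManifold 𝓘(ℝ, E) ∞ M]

/-- The exterior derivative of a 1-form `η`, with the normalization
`2 dη(X, Y) = X (η(Y)) - Y (η(X)) - η([X, Y])`. -/
def dOneForm (η : (x : M) → TangentSpace 𝓘(ℝ, E) x →L[ℝ] ℝ)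
    (X Y : (x : M) → TangentSpace 𝓘(ℝ, E) x) (x : M) : ℝ :=
  (mvfderiv 𝓘(ℝ, E) (fun y ↦ η y (Y y)) x (X x) - mvfderiv 𝓘(ℝ, E) (fun y ↦ η y (X y)) x (Y x)
    - η x (VectorField.mlieBracket 𝓘(ℝ, E) X Y x)) / 2

/-- A 1-form on a 3-dimensional manifold is a contact form if `η ∧ dη` vanishes nowhere; up to a
constant factor `(η ∧ dη)(X, Y, Z)` is `η(X) dη(Y, Z) + η(Y) dη(Z, X) + η(Z) dη(X, Y)`. -/
def IsContactForm₃ (η : (x : M) → TangentSpace 𝓘(ℝ, E) x →L[ℝ] ℝ) : Prop :=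
  ∀ x : M, ∃ X Y Z : (x : M) → TangentSpace 𝓘(ℝ, E) x,
    CMDiffAt ∞ (T% X) x ∧ CMDiffAt ∞ (T% Y) x ∧ CMDiffAt ∞ (T% Z) x ∧
    η x (X x) * dOneForm η Y Z x + η x (Y x) * dOneForm η Z X x + η x (Z x) * dOneForm η X Y x ≠ 0

/-- The Lie derivative of a (1,1)-tensor field: `(L_ξ φ)X = [ξ, φX] - φ[ξ, X]`. -/
def lieDerivEndo (ξ : (x : M) → TangentSpace 𝓘(ℝ, E) x)
    (φ : (x : M) → TangentSpace 𝓘(ℝ, E) x →L[ℝ] TangentSpace 𝓘(ℝ, E) x)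
    (X : (x : M) → TangentSpace 𝓘(ℝ, E) x) (x : M) : TangentSpace 𝓘(ℝ, E) x :=
  VectorField.mlieBracket 𝓘(ℝ, E) ξ (fun y ↦ φ y (X y)) x
    - φ x (VectorField.mlieBracket 𝓘(ℝ, E) ξ X x)

variable [FiniteDimensional ℝ E]
  [RiemannianBundle (fun x : M ↦ TangentSpace 𝓘(ℝ, E) x)]
  [IsContMDiffRiemannianBundle 𝓘(ℝ, E) ∞ E (fun x : M ↦ TangentSpace 𝓘(ℝ, E) x)]

variable (E M) in
/-- A contact metric structure `(φ, ξ, η, g)` on a 3-dimensional manifold, where `g` is the given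
Riemannian metric. Both sides of `dη(X, Y) = g(X, φY)` at a point `x` depend only on the values at
`x` of the fields `X` and `Y`. -/
structure ContactMetricStructure₃ where
  φ : (x : M) → TangentSpace 𝓘(ℝ, E) x →L[ℝ] TangentSpace 𝓘(ℝ, E) x
  ξ : (x : M) → TangentSpace 𝓘(ℝ, E) x
  η : (x : M) → TangentSpace 𝓘(ℝ, E) x →L[ℝ] ℝ
  contMDiff_φ : ContMDiff 𝓘(ℝ, E) (𝓘(ℝ, E).prod 𝓘(ℝ, E →L[ℝ] E)) ∞
    (fun x ↦ TotalSpace.mk' (E →L[ℝ] E)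
      (E := fun x : M ↦ TangentSpace 𝓘(ℝ, E) x →L[ℝ] TangentSpace 𝓘(ℝ, E) x) x (φ x))
  contMDiff_ξ : ContMDiff 𝓘(ℝ, E) (𝓘(ℝ, E).prod 𝓘(ℝ, E)) ∞
    (fun x ↦ TotalSpace.mk' E (E := fun x : M ↦ TangentSpace 𝓘(ℝ, E) x) x (ξ x))
  contMDiff_η : ContMDiff 𝓘(ℝ, E) (𝓘(ℝ, E).prod 𝓘(ℝ, E →L[ℝ] ℝ)) ∞
    (fun x ↦ TotalSpace.mk' (E →L[ℝ] ℝ)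
      (E := fun x : M ↦ TangentSpace 𝓘(ℝ, E) x →L[ℝ] ℝ) x (η x))
  φ_φ : ∀ (x : M) (u : TangentSpace 𝓘(ℝ, E) x), φ x (φ x u) = -u + η x u • ξ x
  φ_ξ : ∀ x : M, φ x (ξ x) = 0
  η_φ : ∀ (x : M) (u : TangentSpace 𝓘(ℝ, E) x), η x (φ x u) = 0
  η_ξ : ∀ x : M, η x (ξ x) = 1
  inner_φ_φ : ∀ (x : M) (u v : TangentSpace 𝓘(ℝ, E) x),
    inner ℝ (φ x u) (φ x v) = inner ℝ u v - η x u * η x v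
  inner_ξ : ∀ (x : M) (u : TangentSpace 𝓘(ℝ, E) x), inner ℝ u (ξ x) = η x u
  isContactForm : IsContactForm₃ η
  dη_eq : ∀ (x : M) (X Y : (x : M) → TangentSpace 𝓘(ℝ, E) x),
    MDiffAt (T% X) x → MDiffAt (T% Y) x → dOneForm η X Y x = inner ℝ (X x) (φ x (Y x))

namespace ContactMetricStructure₃

variable (S : ContactMetricStructure₃ E M)

/-- The tensor `h = (1/2) L_ξ φ`. -/
def h (x : M) (u : TangentSpace 𝓘(ℝ, E) x) : TangentSpace 𝓘(ℝ, E) x :=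
  (1 / 2 : ℝ) • lieDerivEndo S.ξ S.φ (FiberBundle.extend E u) x

/-- `tr h²`. -/
def traceHSq (x : M) : ℝ :=
  tangentTrace x fun u ↦ S.h x (S.h x u)

/-- The *-Ricci tensor `ρ*(u, v) = (1/2) trace (w ↦ R(u, φv)φw)`. -/
def starRicci (x : M) (u v : TangentSpace 𝓘(ℝ, E) x) : ℝ :=
  (1 / 2) * tangentTrace x fun w ↦ curvature x u (S.φ x v) (S.φ x w)

/-- The *-scalar curvature `τ*`, the trace of `Q*`, where `g(Q* u, v) = ρ*(u, v)`. -/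
def starScalarCurvature (x : M) : ℝ :=
  tangentTrace x (raiseIndex x (S.starRicci x))

/-- The contact metric manifold is K-contact if `ξ` is a Killing field, i.e. `L_ξ g = 0`. -/
def IsKContact : Prop :=
  ∀ (x : M) (X Y : (x : M) → TangentSpace 𝓘(ℝ, E) x),
    MDiffAt (T% X) x → MDiffAt (T% Y) x →
    mvfderiv 𝓘(ℝ, E) (fun y ↦ inner ℝ (X y) (Y y)) x (S.ξ x)
      - inner ℝ (VectorField.mlieBracket 𝓘(ℝ, E) S.ξ X x) (Y x)
      - inner ℝ (X x) (VectorField.mlieBracket 𝓘(ℝ, E) S.ξ Y x) = 0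

/-- The almost complex structure on `M × ℝ` with `J X = φX - η(X) ∂/∂t` for `X` tangent to `M`, and
`J (∂/∂t) = ξ`. The tangent space of `M × ℝ` at `p` is `T_{p.1} M × ℝ`. -/
def coneJ (p : M × ℝ) (v : TangentSpace (𝓘(ℝ, E).prod 𝓘(ℝ, ℝ)) p) :
    TangentSpace (𝓘(ℝ, E).prod 𝓘(ℝ, ℝ)) p :=
  let u : TangentSpace 𝓘(ℝ, E) p.1 := (show E × ℝ from v).1
  let a : ℝ := (show E × ℝ from v).2
  show E × ℝ from (S.φ p.1 u + a • S.ξ p.1, -S.η p.1 u)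

/-- The Nijenhuis tensor `[JX, JY] - J[JX, Y] - J[X, JY] - [X, Y]` of `J` on `M × ℝ`. -/
def coneNijenhuis (X Y : (p : M × ℝ) → TangentSpace (𝓘(ℝ, E).prod 𝓘(ℝ, ℝ)) p) (p : M × ℝ) :
    TangentSpace (𝓘(ℝ, E).prod 𝓘(ℝ, ℝ)) p :=
  VectorField.mlieBracket (𝓘(ℝ, E).prod 𝓘(ℝ, ℝ)) (fun q ↦ S.coneJ q (X q)) (fun q ↦ S.coneJ q (Y q)) p
    - S.coneJ p (VectorField.mlieBracket (𝓘(ℝ, E).prod 𝓘(ℝ, ℝ)) (fun q ↦ S.coneJ q (X q)) Y p)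
    - S.coneJ p (VectorField.mlieBracket (𝓘(ℝ, E).prod 𝓘(ℝ, ℝ)) X (fun q ↦ S.coneJ q (Y q)) p)
    - VectorField.mlieBracket (𝓘(ℝ, E).prod 𝓘(ℝ, ℝ)) X Y p

/-- The structure is normal if the almost complex structure `J` on `M × ℝ` is integrable, i.e. its
Nijenhuis tensor vanishes. A contact metric manifold which is normal is called Sasakian. -/
def IsSasakian : Prop :=
  ∀ (p : M × ℝ) (X Y : (p : M × ℝ) → TangentSpace (𝓘(ℝ, E).prod 𝓘(ℝ, ℝ)) p),
    MDiffAt (T% X) p → MDiffAt (T% Y) p → S.coneNijenhuis X Y p = 0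

end ContactMetricStructure₃

end Contact

end ContactGeometry

end

noncomputable section

namespace ContactGeometry

open VectorField Filter Topology

set_option linter.unusedSectionVars false

/-! ### Vector fields, directional derivatives and Lie brackets. -/

section Fields

variable {E : Type*} [NormedAddCommGroup E] [NormedSpace ℝ E]
  {H : Type*} [TopologicalSpace H] {I : ModelWithCorners ℝ E H}
  {M : Type*} [TopologicalSpace M] [ChartedSpace H M] [IsManifold I ∞ M]

/-! Near any point there is a smooth unit field `e` orthogonal to `ξ`, and then `(e, φe, ξ)` is a
local orthonormal frame. Everything is expressed through the three numbers a = g([ξ,e],e), b =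
g([ξ,φe],e), c = g([ξ,e],φe). Applying η to the Jacobi identity for `ξ`, `e`, `φe` gives
g([ξ,φe],φe) = -a. Hence h has the matrix with rows (s, -a), (-a, -s) on the contact plane, where s
= (b+c)/2, and tr h² = 2s² + 2a².

Scalar identity. In this frame τ* is exactly the contribution of the plane (e, φe) to τ, so τ* - τ =
-2 Ric(ξ,ξ), and what remains is Ric(ξ,ξ) = 2 - tr h² (`IsAdaptedAt.inner_curvatureField_add`). The
Koszul formula splits ∇ξ into the skew part dη and the symmetric part ½ L_ξ g (`inner_covDeriv_ξ`),
so ∇ξ is known in terms of a, b, c. Since ∇_ξ ξ = 0, the only derivatives of these functions that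
enter Ric(ξ,ξ) add up to -ξ(div ξ), which vanishes; the rest is algebra.

K-contact implies Sasakian. The Killing equation on (e,e) and (e,φe) gives a = 0 and b + c = 0, so
he = 0. The Nijenhuis tensor N of J is skew and J-antilinear in each argument, and `e`, ∂/∂t span
the tangent space of M × ℝ over J, which has complex dimension 2. So N is determined by N(e, ∂/∂t) =
-[ξ,φe] + φ[ξ,e] = -2he = 0.

The remaining work makes this legitimate: curvature, h and N are shown to be tensorial, so that they
may be computed on the adapted frame. -/

theorem eventually_mdifferentiableAt_section {F : Type*} [NormedAddCommGroup F] [NormedSpace ℝ F]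
    {V : M → Type*} [TopologicalSpace (TotalSpace F V)] [∀ x, AddCommGroup (V x)]
    [∀ x, Module ℝ (V x)] [∀ x, TopologicalSpace (V x)] [FiberBundle F V] [VectorBundle ℝ F V]
    [ContMDiffVectorBundle 1 F V I] {X : (x : M) → V x} {x : M} (hX : CMDiffAt ∞ (T% X) x) :
    ∀ᶠ y in 𝓝 x, MDiffAt (T% X) y :=
  ((contMDiffAt_iff_contMDiffAt_nhds (by simp)).1 (hX.of_le (by simp : (1 : ℕ∞ω) ≤ ∞))).mono
    fun _ hy ↦ hy.mdifferentiableAt (by simp)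

theorem eventually_mdifferentiableAt {F : Type*} [NormedAddCommGroup F] [NormedSpace ℝ F]
    {f : M → F} {x : M} (hf : CMDiffAt ∞ f x) : ∀ᶠ y in 𝓝 x, MDiffAt f y :=
  ((contMDiffAt_iff_contMDiffAt_nhds (by simp)).1 (hf.of_le (by simp : (1 : ℕ∞ω) ≤ ∞))).mono
    fun _ hy ↦ hy.mdifferentiableAt (by simp)

theorem contMDiffAt_mvfderiv_apply {F : Type*} [NormedAddCommGroup F] [NormedSpace ℝ F]
    {f : M → F} {X : (x : M) → TangentSpace I x} {x : M}
    (hf : CMDiffAt ∞ f x) (hX : CMDiffAt ∞ (T% X) x) :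
    CMDiffAt ∞ (fun y ↦ mvfderiv I f y (X y)) x := by
  have h1 := hf.mfderiv_const (m := ∞) (by simp)
  have h2 := ContMDiffAt.clm_apply_of_inCoordinates (b₁ := id) (b₂ := f) (v := X)
    (E₂ := (TangentSpace 𝓘(ℝ, F) : F → Type _)) h1 hX hf
  have h3 := (contMDiffAt_totalSpace.1 h2).2
  simp only [trivializationAt_model_space_apply] at h3
  exact h3

theorem isManifold_minSmoothness_two : IsManifold I (minSmoothness ℝ 2) M := by
  simp only [minSmoothness_of_isRCLikeNormedField]; infer_instance

theorem isManifold_minSmoothness_three : IsManifold I (minSmoothness ℝ 3) M := by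
  simp only [minSmoothness_of_isRCLikeNormedField]; infer_instance

theorem contMDiffAt_mlieBracket [CompleteSpace E] {X Y : (x : M) → TangentSpace I x} {x : M}
    (hX : CMDiffAt ∞ (T% X) x) (hY : CMDiffAt ∞ (T% Y) x) :
    CMDiffAt ∞ (T% (mlieBracket I X Y)) x := by
  have : IsManifold I ((⊤ : ℕ∞) + 1 : ℕ∞ω) M := by simpa using ‹IsManifold I ∞ M›
  have := isManifold_minSmoothness_two (I := I) (M := M)
  exact ContMDiffAt.mlieBracket_vectorField (m := ⊤) (n := ⊤) hX hY (by simp)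

theorem mlieBracket_congr {X X' Y Y' : (x : M) → TangentSpace I x} {x : M}
    (hX : ∀ᶠ y in 𝓝 x, X y = X' y) (hY : ∀ᶠ y in 𝓝 x, Y y = Y' y) :
    mlieBracket I X Y x = mlieBracket I X' Y' x :=
  Filter.EventuallyEq.mlieBracket_vectorField_eq hX hY

theorem mvfderiv_congr {F : Type*} [NormedAddCommGroup F] [NormedSpace ℝ F]
    {f g : M → F} {x : M} (h : ∀ᶠ y in 𝓝 x, f y = g y) (v : TangentSpace I x) :
    mvfderiv I f x v = mvfderiv I g x v := by
  have : f =ᶠ[𝓝 x] g := h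
  simp only [mvfderiv, this.mfderiv_eq]
  rfl

theorem mvfderiv_eq_zero_of_eventually_const {F : Type*} [NormedAddCommGroup F] [NormedSpace ℝ F]
    {f : M → F} {c : F} {x : M} (h : ∀ᶠ y in 𝓝 x, f y = c) (v : TangentSpace I x) :
    mvfderiv I f x v = 0 := by
  rw [mvfderiv_congr (g := fun _ ↦ c) h, mvfderiv_const]; rfl

/-- The commutator formula `[X, Y] f = X Y f - Y X f`, which follows formally from the Jacobi
identity for `X`, `Y` and `f • Z`. -/
theorem mvfderiv_mlieBracket_smul [CompleteSpace E] {X Y Z : (x : M) → TangentSpace I x} {f : M → ℝ} {x : M}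
    (hX : CMDiffAt ∞ (T% X) x) (hY : CMDiffAt ∞ (T% Y) x) (hZ : CMDiffAt ∞ (T% Z) x)
    (hf : CMDiffAt ∞ f x) :
    (mvfderiv I f x (mlieBracket I X Y x)) • Z x =
      (mvfderiv I (fun y ↦ mvfderiv I f y (Y y)) x (X x)
        - mvfderiv I (fun y ↦ mvfderiv I f y (X y)) x (Y x)) • Z x := by
  have := isManifold_minSmoothness_three (I := I) (M := M)
  have h2 : (minSmoothness ℝ 2) ≤ (∞ : ℕ∞ω) := by
    simp only [minSmoothness_of_isRCLikeNormedField]; exact ENat.LEInfty.out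
  have key (W : (x : M) → TangentSpace I x) (hW : CMDiffAt ∞ (T% W) x) :=
    leibniz_identity_mlieBracket_apply (hX.of_le h2) (hY.of_le h2) (hW.of_le h2)
  have expand (U : (x : M) → TangentSpace I x) :
      ∀ᶠ y in 𝓝 x, mlieBracket I U (f • Z) y =
        ((fun y ↦ mvfderiv I f y (U y)) • Z + f • mlieBracket I U Z) y := by
    filter_upwards [eventually_mdifferentiableAt hf, eventually_mdifferentiableAt_section hZ]
      with y h1 h2
    rw [mlieBracket_smul_right h1 h2]; rfl
  have expand2 (U V : (x : M) → TangentSpace I x) (hU : CMDiffAt ∞ (T% U) x)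
      (hV : CMDiffAt ∞ (T% V) x) : mlieBracket I U (mlieBracket I V (f • Z)) x =
        mvfderiv I (fun y ↦ mvfderiv I f y (V y)) x (U x) • Z x
        + mvfderiv I f x (V x) • mlieBracket I U Z x
        + (mvfderiv I f x (U x) • mlieBracket I V Z x
          + f x • mlieBracket I U (mlieBracket I V Z) x) := by
    have hVf := contMDiffAt_mvfderiv_apply hf hV
    have hVZ := contMDiffAt_mlieBracket hV hZ
    have d1 := hVf.mdifferentiableAt (by simp)
    have d2 := hVZ.mdifferentiableAt (by simp)
    have d3 := hf.mdifferentiableAt (by simp)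
    have d4 := hZ.mdifferentiableAt (by simp)
    rw [mlieBracket_congr (Eventually.of_forall fun _ ↦ rfl) (expand V),
      mlieBracket_add_right (d1.smul_section d4) (d3.smul_section d2),
      mlieBracket_smul_right d1 d4, mlieBracket_smul_right d3 d2]
  -- Subtract f times the Jacobi identity for Z from the one for f Z. The terms in [X,Z] and [Y,Z]
  -- occur on both sides and cancel, leaving only derivatives of f times Z.
  have h1 := key Z hZ
  have h2 := key (f • Z) (hf.smul_section hZ)
  rw [expand2 X Y hX hY, expand2 Y X hY hX, (expand _).self_of_nhds] at h2
  simp only [Pi.add_apply, Pi.smul_apply', h1, smul_add] at h2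
  rw [sub_smul]
  generalize mlieBracket I Y Z x = a1 at *
  generalize mlieBracket I X Z x = a2 at *
  rw [← sub_eq_zero] at h2 ⊢
  rw [← neg_eq_zero, ← h2]
  abel

end Fields

/-! ### Operations on smooth vector fields that depend only on the value at a point. -/

section Tensoriality

variable {E : Type*} [NormedAddCommGroup E] [NormedSpace ℝ E]
  {M : Type*} [TopologicalSpace M] [ChartedSpace E M] [IsManifold 𝓘(ℝ, E) ∞ M]
  {A : Type*} [AddCommGroup A] [Module ℝ A]

/-- An operation on vector fields is smoothly tensorial at `x` if it is additive and homogeneous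
on fields which are smooth at `x`. -/
structure SmoothTensorialAt (Φ : ((x : M) → TangentSpace 𝓘(ℝ, E) x) → A) (x : M) : Prop where
  smul : ∀ {f : M → ℝ} {X : (x : M) → TangentSpace 𝓘(ℝ, E) x},
    CMDiffAt ∞ f x → CMDiffAt ∞ (T% X) x → Φ (f • X) = f x • Φ X
  add : ∀ {X X' : (x : M) → TangentSpace 𝓘(ℝ, E) x},
    CMDiffAt ∞ (T% X) x → CMDiffAt ∞ (T% X') x → Φ (X + X') = Φ X + Φ X'

namespace SmoothTensorialAt

variable {Φ : ((x : M) → TangentSpace 𝓘(ℝ, E) x) → A} {x : M}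

/-- The indicator function of the set where the two fields agree is 1 near x, hence smooth at x, and
multiplying by it makes the two fields equal everywhere. No bump function is needed. -/
theorem congr_of_eventually_eq (hΦ : SmoothTensorialAt Φ x)
    {X X' : (x : M) → TangentSpace 𝓘(ℝ, E) x} (hX : CMDiffAt ∞ (T% X) x)
    (hX' : CMDiffAt ∞ (T% X') x) (h : ∀ᶠ y in 𝓝 x, X y = X' y) : Φ X = Φ X' := by
  classical
  let ψ (y : M) : ℝ := if X y = X' y then 1 else 0
  have hψx : ψ x = 1 := by simp [ψ, h.self_of_nhds]
  have hψX : ψ • X = ψ • X' := by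
    funext y
    by_cases hy : X y = X' y <;> simp [ψ, hy]
  have hψ : CMDiffAt ∞ ψ x := by
    have : CMDiffAt ∞ (fun _ : M ↦ (1 : ℝ)) x := contMDiffAt_const
    exact this.congr_of_eventuallyEq (h.mono fun y hy ↦ by simp [ψ, hy])
  have h1 := hΦ.smul hψ hX
  have h2 := hΦ.smul hψ hX'
  rw [hψx, one_smul] at h1 h2
  rw [← h1, ← h2, hψX]

theorem zero (hΦ : SmoothTensorialAt Φ x) : Φ 0 = 0 := by
  have h := hΦ.smul (f := fun _ ↦ 0) (X := 0) contMDiffAt_const (contMDiff_zeroSection ℝ _).contMDiffAt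
  simpa using h

theorem sum (hΦ : SmoothTensorialAt Φ x) {ι : Type*} {s : Finset ι}
    (X : ι → (x : M) → TangentSpace 𝓘(ℝ, E) x) (hX : ∀ i, CMDiffAt ∞ (T% (X i)) x) :
    Φ (fun y ↦ ∑ i ∈ s, X i y) = ∑ i ∈ s, Φ (X i) := by
  classical
  induction s using Finset.induction_on with
  | empty => simp only [Finset.sum_empty]; exact hΦ.zero
  | insert a s ha h =>
    simp only [Finset.sum_insert ha, ← h]
    exact hΦ.add (hX a) (ContMDiffAt.sum_section fun i _ ↦ hX i)

/-- Near x a field is the combination of a local frame with smooth coefficients, so Φ sees only the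
coefficients at x. Smoothness, rather than differentiability at x, is the right class here because
curvature differentiates its arguments twice. -/
theorem congr_of_eq [FiniteDimensional ℝ E] (hΦ : SmoothTensorialAt Φ x)
    {X X' : (x : M) → TangentSpace 𝓘(ℝ, E) x} (hX : CMDiffAt ∞ (T% X) x)
    (hX' : CMDiffAt ∞ (T% X') x) (h : X x = X' x) : Φ X = Φ X' := by
  let t := trivializationAt E (TangentSpace 𝓘(ℝ, E) : M → Type _) x
  have x_mem : x ∈ t.baseSet := FiberBundle.mem_baseSet_trivializationAt E _ x
  let b := Module.Basis.ofVectorSpace ℝ E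
  let s := t.localFrame b
  let c := t.localFrameCoeff 𝓘(ℝ, E) b
  have hs (i) : CMDiffAt ∞ (T% (s i)) x := contMDiffAt_localFrame_of_mem ∞ _ b i x_mem
  have hc {Y : (x : M) → TangentSpace 𝓘(ℝ, E) x} (hY : CMDiffAt ∞ (T% Y) x) (i) :
      CMDiffAt ∞ (LinearMap.piApply (c i) Y) x :=
    contMDiffAt_localFrameCoeff b x_mem hY i
  have hΦ_eq {Y : (x : M) → TangentSpace 𝓘(ℝ, E) x} (hY : CMDiffAt ∞ (T% Y) x) :
      Φ Y = ∑ i, c i x (Y x) • Φ (s i) := by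
    have h1 (i) : CMDiffAt ∞ (T% (LinearMap.piApply (c i) Y • s i)) x :=
      (hc hY i).smul_section (hs i)
    rw [hΦ.congr_of_eventually_eq hY (ContMDiffAt.sum_section fun i (_ : i ∈ Finset.univ) ↦ h1 i)
      (t.eventually_eq_localFrame_sum_coeff_smul b x_mem), hΦ.sum _ h1]
    exact Finset.sum_congr rfl fun i _ ↦ hΦ.smul (hc hY i) (hs i)
  rw [hΦ_eq hX, hΦ_eq hX', h]

theorem extend_add [FiniteDimensional ℝ E] (hΦ : SmoothTensorialAt Φ x)
    (u v : TangentSpace 𝓘(ℝ, E) x) :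
    Φ (FiberBundle.extend E (u + v)) = Φ (FiberBundle.extend E u) + Φ (FiberBundle.extend E v) := by
  have hu := FiberBundle.contMDiffAt_extend (k := ∞) 𝓘(ℝ, E) E u
  have hv := FiberBundle.contMDiffAt_extend (k := ∞) 𝓘(ℝ, E) E v
  rw [← hΦ.add hu hv]
  exact hΦ.congr_of_eq (FiberBundle.contMDiffAt_extend ..) (hu.add_section hv) (by simp)

theorem extend_smul [FiniteDimensional ℝ E] (hΦ : SmoothTensorialAt Φ x) (a : ℝ)
    (u : TangentSpace 𝓘(ℝ, E) x) :
    Φ (FiberBundle.extend E (a • u)) = a • Φ (FiberBundle.extend E u) := by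
  have hu := FiberBundle.contMDiffAt_extend (k := ∞) 𝓘(ℝ, E) E u
  have ha : CMDiffAt ∞ (fun _ : M ↦ a) x := contMDiffAt_const
  rw [← hΦ.smul ha hu]
  exact hΦ.congr_of_eq (FiberBundle.contMDiffAt_extend ..) (ha.smul_section hu) (by simp)

theorem apply_eq_extend [FiniteDimensional ℝ E] (hΦ : SmoothTensorialAt Φ x)
    {X : (x : M) → TangentSpace 𝓘(ℝ, E) x} (hX : CMDiffAt ∞ (T% X) x) :
    Φ (FiberBundle.extend E (X x)) = Φ X :=
  hΦ.congr_of_eq (FiberBundle.contMDiffAt_extend ..) hX (by simp)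

end SmoothTensorialAt

end Tensoriality

/-! ### Covariant derivative, curvature tensor and traces in an orthonormal frame. -/

section Riemannian

variable {E : Type*} [NormedAddCommGroup E] [NormedSpace ℝ E] [FiniteDimensional ℝ E]
  {M : Type*} [TopologicalSpace M] [ChartedSpace E M] [IsManifold 𝓘(ℝ, E) ∞ M]
  [RiemannianBundle (fun x : M ↦ TangentSpace 𝓘(ℝ, E) x)]
  [IsContMDiffRiemannianBundle 𝓘(ℝ, E) ∞ E (fun x : M ↦ TangentSpace 𝓘(ℝ, E) x)]

theorem contMDiffAt_inner {X Y : (x : M) → TangentSpace 𝓘(ℝ, E) x} {x : M}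
    (hX : CMDiffAt ∞ (T% X) x) (hY : CMDiffAt ∞ (T% Y) x) :
    CMDiffAt ∞ (fun y ↦ (inner ℝ (X y) (Y y) : ℝ)) x :=
  ContMDiffAt.inner_bundle (IB := 𝓘(ℝ, E)) (F := E)
    (E := fun x : M ↦ TangentSpace 𝓘(ℝ, E) x) (b := fun y ↦ y) (v := X) (w := Y) hX hY

/-- The covariant derivative `∇_X Y` of vector fields. -/
def covDeriv (X Y : (x : M) → TangentSpace 𝓘(ℝ, E) x) (x : M) : TangentSpace 𝓘(ℝ, E) x :=
  leviCivita E M Y x (X x)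

/-- The fields `e i` are smooth at `x` and form an orthonormal frame near `x`. -/
structure IsOrthonormalFrameAt {ι : Type*} [Fintype ι] (e : ι → (x : M) → TangentSpace 𝓘(ℝ, E) x)
    (x : M) : Prop where
  contMDiffAt : ∀ i, CMDiffAt ∞ (T% (e i)) x
  exists_basis : ∀ᶠ y in 𝓝 x, ∃ b : OrthonormalBasis ι ℝ (TangentSpace 𝓘(ℝ, E) y),
    ∀ i, b i = e i y

variable {ι : Type*} [Fintype ι] {e : ι → (x : M) → TangentSpace 𝓘(ℝ, E) x} {x : M}
  {X Y Z W : (x : M) → TangentSpace 𝓘(ℝ, E) x}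

theorem contMDiffAt_koszul (hX : CMDiffAt ∞ (T% X) x) (hY : CMDiffAt ∞ (T% Y) x)
    (hZ : CMDiffAt ∞ (T% Z) x) : CMDiffAt ∞ (koszul X Y Z) x := by
  have h1 := contMDiffAt_mvfderiv_apply (contMDiffAt_inner hY hZ) hX
  have h2 := contMDiffAt_mvfderiv_apply (contMDiffAt_inner hX hZ) hY
  have h3 := contMDiffAt_mvfderiv_apply (contMDiffAt_inner hX hY) hZ
  have h4 := contMDiffAt_inner (contMDiffAt_mlieBracket hX hY) hZ
  have h5 := contMDiffAt_inner (contMDiffAt_mlieBracket hX hZ) hY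
  have h6 := contMDiffAt_inner (contMDiffAt_mlieBracket hY hZ) hX
  exact (((((h1.add h2).sub h3).add h4).sub h5).sub h6).div_const 2

/-- The connection is defined pointwise with orthonormal bases chosen without any continuity. In a
smooth orthonormal frame its coefficients are Koszul expressions, which are visibly smooth. -/
theorem IsOrthonormalFrameAt.contMDiffAt_covDeriv (he : IsOrthonormalFrameAt e x)
    (hX : CMDiffAt ∞ (T% X) x) (hY : CMDiffAt ∞ (T% Y) x) :
    CMDiffAt ∞ (T% (covDeriv X Y)) x := by
  have h (i) := (contMDiffAt_koszul hX hY (he.contMDiffAt i)).smul_section (he.contMDiffAt i)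
  refine (ContMDiffAt.sum_section fun i (_ : i ∈ Finset.univ) ↦ h i).congr_of_eventuallyEq ?_
  have hd : ∀ᶠ y in 𝓝 x, ∀ i, MDiffAt (T% (e i)) y :=
    eventually_all.2 fun i ↦ eventually_mdifferentiableAt_section (he.contMDiffAt i)
  filter_upwards [he.exists_basis, hd, eventually_mdifferentiableAt_section hX,
    eventually_mdifferentiableAt_section hY] with y ⟨b, hb⟩ hd h1 h2
  congr 1
  have h3 : covDeriv X Y y = ∑ i, koszul X Y (e i) y • e i y := by
    rw [← b.sum_repr' (covDeriv X Y y)]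
    refine Finset.sum_congr rfl fun i _ ↦ ?_
    rw [hb, real_inner_comm, ← inner_koszulDerivative h1 (hd i) h2]
    rfl
  simpa using h3

theorem covDeriv_add_right (hY : MDiffAt (T% Y) x) (hZ : MDiffAt (T% Z) x) :
    covDeriv X (Y + Z) x = covDeriv X Y x + covDeriv X Z x := by
  simp only [covDeriv]
  rw [(leviCivita E M).isCovariantDerivativeOnUniv.add hY hZ]
  rfl

theorem covDeriv_smul_right {f : M → ℝ} (hf : MDiffAt f x) (hY : MDiffAt (T% Y) x) :
    covDeriv X (f • Y) x = f x • covDeriv X Y x + mvfderiv 𝓘(ℝ, E) f x (X x) • Y x := by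
  simp only [covDeriv]
  rw [(leviCivita E M).isCovariantDerivativeOnUniv.leibniz hY hf]
  rfl

theorem covDeriv_congr (hY : MDiffAt (T% Y) x) (h : ∀ᶠ y in 𝓝 x, Y y = Z y) :
    covDeriv X Y x = covDeriv X Z x := by
  have hZ : MDiffAt (T% Z) x := hY.congr_of_eventuallyEq (h.mono fun y hy ↦ by simp [hy])
  simp only [covDeriv]
  rw [(leviCivita E M).isCovariantDerivativeOnUniv.congr_of_eventuallyEq hY hZ univ_mem h]

theorem inner_covDeriv_add (hX : MDiffAt (T% X) x) (hY : MDiffAt (T% Y) x)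
    (hZ : MDiffAt (T% Z) x) :
    inner ℝ (covDeriv X Y x) (Z x) + inner ℝ (Y x) (covDeriv X Z x)
      = mvfderiv 𝓘(ℝ, E) (fun y ↦ inner ℝ (Y y) (Z y)) x (X x) :=
  (leviCivita_metric hX hY hZ).symm

theorem covDeriv_sub_covDeriv (hX : MDiffAt (T% X) x) (hY : MDiffAt (T% Y) x) :
    covDeriv X Y x - covDeriv Y X x = mlieBracket 𝓘(ℝ, E) X Y x :=
  (CovariantDerivative.torsion_eq_zero_iff _).1 leviCivita_torsion hX hY

theorem curvatureField_eq (X Y Z : (x : M) → TangentSpace 𝓘(ℝ, E) x) (x : M) :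
    curvatureField X Y Z x = covDeriv X (covDeriv Y Z) x - covDeriv Y (covDeriv X Z) x
      - covDeriv (mlieBracket 𝓘(ℝ, E) X Y) Z x :=
  rfl

theorem curvatureField_swap (X Y Z : (x : M) → TangentSpace 𝓘(ℝ, E) x) (x : M) :
    curvatureField X Y Z x = -curvatureField Y X Z x := by
  simp only [curvatureField_eq]
  rw [mlieBracket_swap]
  simp only [covDeriv, Pi.neg_apply, map_neg]
  abel

namespace IsOrthonormalFrameAt

theorem smoothTensorialAt_curvatureField_left (he : IsOrthonormalFrameAt e x)
    (hZ : CMDiffAt ∞ (T% Z) x) :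
    SmoothTensorialAt (fun X ↦ curvatureField X Y Z x) x where
  smul {f X} hf hX := by
    have hf' := hf.mdifferentiableAt (by simp)
    have hX' := hX.mdifferentiableAt (by simp)
    have h := (he.contMDiffAt_covDeriv hX hZ).mdifferentiableAt (by simp)
    have h1 : covDeriv (f • X) Z = f • covDeriv X Z := by
      funext y; simp [covDeriv]
    simp only [curvatureField_eq, h1, covDeriv_smul_right hf' h]
    simp only [covDeriv, mlieBracket_smul_left hf' hX', map_add, map_smul, map_neg, neg_smul,
      Pi.smul_apply']
    module
  add {X X'} hX hX' := by
    have h := (he.contMDiffAt_covDeriv hX hZ).mdifferentiableAt (by simp)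
    have h' := (he.contMDiffAt_covDeriv hX' hZ).mdifferentiableAt (by simp)
    have h1 : covDeriv (X + X') Z = covDeriv X Z + covDeriv X' Z := by
      funext y; simp [covDeriv]
    simp only [curvatureField_eq, h1, covDeriv_add_right h h']
    simp only [covDeriv, mlieBracket_add_left (hX.mdifferentiableAt (by simp))
      (hX'.mdifferentiableAt (by simp)), map_add, Pi.add_apply]
    abel

theorem smoothTensorialAt_curvatureField_middle (he : IsOrthonormalFrameAt e x)
    (hZ : CMDiffAt ∞ (T% Z) x) :
    SmoothTensorialAt (fun Y ↦ curvatureField X Y Z x) x where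
  smul hf hY := by
    simp only [curvatureField_swap X]
    rw [(he.smoothTensorialAt_curvatureField_left hZ).smul hf hY, smul_neg]
  add hY hY' := by
    simp only [curvatureField_swap X]
    rw [(he.smoothTensorialAt_curvatureField_left hZ).add hY hY', neg_add]

/-- Expanding ∇_U ∇_V (f Z), the terms with one derivative of f are symmetric in U and V and drop
out of the curvature. The second derivatives of f leave XYf - YXf, which cancels the term [X,Y]f
coming from ∇_[X,Y]. -/
theorem smoothTensorialAt_curvatureField_right (he : IsOrthonormalFrameAt e x)
    (hX : CMDiffAt ∞ (T% X) x) (hY : CMDiffAt ∞ (T% Y) x) :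
    SmoothTensorialAt (fun Z ↦ curvatureField X Y Z x) x where
  smul {f Z} hf hZ := by
    have hf' := hf.mdifferentiableAt (by simp)
    have hZ' := hZ.mdifferentiableAt (by simp)
    have expand (U V : (x : M) → TangentSpace 𝓘(ℝ, E) x) (hU : CMDiffAt ∞ (T% U) x)
        (hV : CMDiffAt ∞ (T% V) x) : covDeriv U (covDeriv V (f • Z)) x =
          f x • covDeriv U (covDeriv V Z) x + mvfderiv 𝓘(ℝ, E) f x (U x) • covDeriv V Z x
          + (mvfderiv 𝓘(ℝ, E) f x (V x) • covDeriv U Z x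
            + mvfderiv 𝓘(ℝ, E) (fun y ↦ mvfderiv 𝓘(ℝ, E) f y (V y)) x (U x) • Z x) := by
      have h1 : ∀ᶠ y in 𝓝 x, (f • covDeriv V Z + (fun y ↦ mvfderiv 𝓘(ℝ, E) f y (V y)) • Z) y
          = covDeriv V (f • Z) y := by
        filter_upwards [eventually_mdifferentiableAt hf, eventually_mdifferentiableAt_section hZ]
          with y h1 h2
        rw [covDeriv_smul_right h1 h2]
        rfl
      have h2 := (he.contMDiffAt_covDeriv hV hZ).mdifferentiableAt (by simp)
      have h3 := (contMDiffAt_mvfderiv_apply hf hV).mdifferentiableAt (by simp)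
      have h4 := hf'.smul_section h2
      have h5 := h3.smul_section hZ'
      rw [← covDeriv_congr (mdifferentiableAt_add_section h4 h5) h1, covDeriv_add_right h4 h5,
        covDeriv_smul_right hf' h2, covDeriv_smul_right h3 hZ']
    have h := mvfderiv_mlieBracket_smul hX hY hZ hf
    simp only [curvatureField_eq, expand X Y hX hY, expand Y X hY hX, covDeriv_smul_right hf' hZ', h]
    module
  add {Z Z'} hZ hZ' := by
    have expand (U V : (x : M) → TangentSpace 𝓘(ℝ, E) x) (hU : CMDiffAt ∞ (T% U) x)
        (hV : CMDiffAt ∞ (T% V) x) : covDeriv U (covDeriv V (Z + Z')) x =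
          covDeriv U (covDeriv V Z) x + covDeriv U (covDeriv V Z') x := by
      have h1 : ∀ᶠ y in 𝓝 x, (covDeriv V Z + covDeriv V Z') y = covDeriv V (Z + Z') y := by
        filter_upwards [eventually_mdifferentiableAt_section hZ',
          eventually_mdifferentiableAt_section hZ] with y h1 h2
        rw [covDeriv_add_right h2 h1]
        rfl
      have h2 := (he.contMDiffAt_covDeriv hV hZ).mdifferentiableAt (by simp)
      have h3 := (he.contMDiffAt_covDeriv hV hZ').mdifferentiableAt (by simp)
      rw [← covDeriv_congr (mdifferentiableAt_add_section h2 h3) h1, covDeriv_add_right h2 h3]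
    simp only [curvatureField_eq, expand X Y hX hY, expand Y X hY hX,
      covDeriv_add_right (hZ.mdifferentiableAt (by simp)) (hZ'.mdifferentiableAt (by simp))]
    abel

theorem curvature_apply (he : IsOrthonormalFrameAt e x) (hX : CMDiffAt ∞ (T% X) x)
    (hY : CMDiffAt ∞ (T% Y) x) (hZ : CMDiffAt ∞ (T% Z) x) :
    curvature x (X x) (Y x) (Z x) = curvatureField X Y Z x := by
  have h (v : TangentSpace 𝓘(ℝ, E) x) := FiberBundle.contMDiffAt_extend (k := ∞) 𝓘(ℝ, E) E v
  rw [curvature, (he.smoothTensorialAt_curvatureField_left (h _)).apply_eq_extend hX,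
    (he.smoothTensorialAt_curvatureField_middle (h _)).apply_eq_extend hY,
    (he.smoothTensorialAt_curvatureField_right hX hY).apply_eq_extend hZ]

/-- The curvature tensor as a trilinear map. -/
def curvatureLinear (he : IsOrthonormalFrameAt e x) :
    TangentSpace 𝓘(ℝ, E) x →ₗ[ℝ] TangentSpace 𝓘(ℝ, E) x →ₗ[ℝ]
      TangentSpace 𝓘(ℝ, E) x →ₗ[ℝ] TangentSpace 𝓘(ℝ, E) x :=
  have h (v : TangentSpace 𝓘(ℝ, E) x) := FiberBundle.contMDiffAt_extend (k := ∞) 𝓘(ℝ, E) E v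
  LinearMap.mk₂ ℝ (fun u v ↦
    { toFun := fun w ↦ curvature x u v w
      map_add' := (he.smoothTensorialAt_curvatureField_right (h u) (h v)).extend_add
      map_smul' := (he.smoothTensorialAt_curvatureField_right (h u) (h v)).extend_smul })
    (fun u u' _ ↦ LinearMap.ext fun w ↦
      (he.smoothTensorialAt_curvatureField_left (h w)).extend_add u u')
    (fun a u _ ↦ LinearMap.ext fun w ↦
      (he.smoothTensorialAt_curvatureField_left (h w)).extend_smul a u)
    (fun _ v v' ↦ LinearMap.ext fun w ↦
      (he.smoothTensorialAt_curvatureField_middle (h w)).extend_add v v')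
    (fun a _ v ↦ LinearMap.ext fun w ↦
      (he.smoothTensorialAt_curvatureField_middle (h w)).extend_smul a v)

@[simp]
theorem curvatureLinear_apply (he : IsOrthonormalFrameAt e x) (u v w : TangentSpace 𝓘(ℝ, E) x) :
    he.curvatureLinear u v w = curvature x u v w := rfl

/-- Differentiate g(Z,W) = c along Y and then X, and antisymmetrise: the products of first
derivatives are symmetric and cancel. The constancy assumption holds for frame fields and avoids
commuting derivatives of g(Z,W). -/
theorem inner_curvatureField_eq_neg (he : IsOrthonormalFrameAt e x) (hX : CMDiffAt ∞ (T% X) x)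
    (hY : CMDiffAt ∞ (T% Y) x) (hZ : CMDiffAt ∞ (T% Z) x) (hW : CMDiffAt ∞ (T% W) x) {c : ℝ}
    (hc : ∀ᶠ y in 𝓝 x, inner ℝ (Z y) (W y) = c) :
    inner ℝ (curvatureField X Y Z x) (W x) = -inner ℝ (curvatureField X Y W x) (Z x) := by
  have first : ∀ᶠ y in 𝓝 x, ∀ U : (x : M) → TangentSpace 𝓘(ℝ, E) x, MDiffAt (T% U) y →
      inner ℝ (covDeriv U Z y) (W y) + inner ℝ (Z y) (covDeriv U W y) = 0 := by
    filter_upwards [eventually_mdifferentiableAt_section hZ,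
      eventually_mdifferentiableAt_section hW, eventually_eventually_nhds.2 hc] with y h1 h2 h3 U hU
    rw [inner_covDeriv_add hU h1 h2, mvfderiv_eq_zero_of_eventually_const h3]
  have second (U V : (x : M) → TangentSpace 𝓘(ℝ, E) x) (hU : CMDiffAt ∞ (T% U) x)
      (hV : CMDiffAt ∞ (T% V) x) :
      inner ℝ (covDeriv U (covDeriv V Z) x) (W x) + inner ℝ (covDeriv V Z x) (covDeriv U W x)
        + (inner ℝ (covDeriv U Z x) (covDeriv V W x)
          + inner ℝ (Z x) (covDeriv U (covDeriv V W) x)) = 0 := by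
    have hU' := hU.mdifferentiableAt (by simp)
    have dW := hW.mdifferentiableAt (by simp)
    have dZ := hZ.mdifferentiableAt (by simp)
    have cZ := (he.contMDiffAt_covDeriv hV hZ).mdifferentiableAt (by simp)
    have cW := (he.contMDiffAt_covDeriv hV hW).mdifferentiableAt (by simp)
    rw [inner_covDeriv_add hU' cZ dW, inner_covDeriv_add hU' dZ cW, ← add_apply,
      ← mvfderiv_fun_add (mdifferentiableAt_inner cZ dW) (mdifferentiableAt_inner dZ cW)]
    apply mvfderiv_eq_zero_of_eventually_const (c := 0)
    filter_upwards [first, eventually_mdifferentiableAt_section hV] with y h1 h2 using h1 V h2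
  have h1 := second X Y hX hY
  have h2 := second Y X hY hX
  have h3 := first.self_of_nhds _ ((contMDiffAt_mlieBracket hX hY).mdifferentiableAt (by simp))
  simp only [curvatureField_eq, inner_sub_left]
  rw [real_inner_comm _ (Z x)] at h1 h2 h3
  linarith

end IsOrthonormalFrameAt

/-- The trace of a bilinear form does not depend on the orthonormal basis. -/
theorem sum_apply_self_eq_of_orthonormalBasis {V : Type*} [NormedAddCommGroup V]
    [InnerProductSpace ℝ V] {ι κ : Type*} [Fintype ι] [Fintype κ] (B : V →ₗ[ℝ] V →ₗ[ℝ] ℝ)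
    (b : OrthonormalBasis ι ℝ V) (c : OrthonormalBasis κ ℝ V) :
    ∑ i, B (b i) (b i) = ∑ j, B (c j) (c j) := by
  classical
  have h (i) : B (b i) (b i)
      = ∑ j, ∑ k, inner ℝ (c j) (b i) * inner ℝ (b i) (c k) * B (c k) (c j) := by
    nth_rw 1 2 [← c.sum_repr' (b i)]
    simp only [map_sum, map_smul, LinearMap.sum_apply, LinearMap.smul_apply, smul_eq_mul,
      Finset.mul_sum]
    refine Finset.sum_congr rfl fun j _ ↦ Finset.sum_congr rfl fun k _ ↦ ?_
    rw [real_inner_comm (b i) (c k)]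
    ring
  simp only [h]
  rw [Finset.sum_comm]
  refine Finset.sum_congr rfl fun j _ ↦ ?_
  rw [Finset.sum_comm]
  have h2 (k) : ∑ i, inner ℝ (c j) (b i) * inner ℝ (b i) (c k) * B (c k) (c j)
      = if j = k then B (c k) (c j) else 0 := by
    rw [← Finset.sum_mul, b.sum_inner_mul_inner, orthonormal_iff_ite.1 c.orthonormal]
    split_ifs <;> simp
  simp [h2]

theorem tangentTrace_eq_sum {κ : Type*} [Fintype κ]
    (A : TangentSpace 𝓘(ℝ, E) x →ₗ[ℝ] TangentSpace 𝓘(ℝ, E) x)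
    (b : OrthonormalBasis κ ℝ (TangentSpace 𝓘(ℝ, E) x)) :
    tangentTrace x A = ∑ i, inner ℝ (A (b i)) (b i) :=
  sum_apply_self_eq_of_orthonormalBasis ((innerₗ _).comp A) _ b

theorem tangentTrace_raiseIndex {κ : Type*} [Fintype κ]
    (B : TangentSpace 𝓘(ℝ, E) x →ₗ[ℝ] TangentSpace 𝓘(ℝ, E) x →ₗ[ℝ] ℝ)
    (b : OrthonormalBasis κ ℝ (TangentSpace 𝓘(ℝ, E) x)) :
    tangentTrace x (raiseIndex x fun u v ↦ B u v) = ∑ i, B (b i) (b i) := by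
  rw [← sum_apply_self_eq_of_orthonormalBasis B (stdOrthonormalBasis ℝ _) b]
  refine Finset.sum_congr rfl fun i _ ↦ ?_
  simp [raiseIndex, sum_inner, real_inner_smul_left, orthonormal_iff_ite.1
    (stdOrthonormalBasis ℝ (TangentSpace 𝓘(ℝ, E) x)).orthonormal]

end Riemannian

/-! ### Contact metric structures, adapted frames and the tensor h. -/

section ContactMetric

variable {E : Type*} [NormedAddCommGroup E] [NormedSpace ℝ E] [FiniteDimensional ℝ E]
  {M : Type*} [TopologicalSpace M] [ChartedSpace E M] [IsManifold 𝓘(ℝ, E) ∞ M]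
  [RiemannianBundle (fun x : M ↦ TangentSpace 𝓘(ℝ, E) x)]
  [IsContMDiffRiemannianBundle 𝓘(ℝ, E) ∞ E (fun x : M ↦ TangentSpace 𝓘(ℝ, E) x)]

namespace ContactMetricStructure₃

variable (S : ContactMetricStructure₃ E M) {x : M} {X Y e : (x : M) → TangentSpace 𝓘(ℝ, E) x}

theorem contMDiffAt_φ_apply (hX : CMDiffAt ∞ (T% X) x) :
    CMDiffAt ∞ (T% (fun y ↦ S.φ y (X y))) x :=
  ContMDiffAt.clm_bundle_apply (b := fun y : M ↦ y) (ϕ := S.φ) (v := X) S.contMDiff_φ.contMDiffAt hX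

theorem mdifferentiableAt_ξ : MDiffAt (T% S.ξ) x :=
  S.contMDiff_ξ.contMDiffAt.mdifferentiableAt (by simp)

theorem inner_ξ_left (u : TangentSpace 𝓘(ℝ, E) x) : inner ℝ (S.ξ x) u = S.η x u := by
  rw [real_inner_comm, S.inner_ξ]

theorem inner_φ_left (u v : TangentSpace 𝓘(ℝ, E) x) :
    inner ℝ (S.φ x u) v = -inner ℝ u (S.φ x v) := by
  have h := S.inner_φ_φ x u (S.φ x v)
  rw [S.φ_φ, S.η_φ, inner_add_right, inner_neg_right, inner_smul_right, S.inner_ξ, S.η_φ] at h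
  linarith

theorem contMDiffAt_η_apply (hX : CMDiffAt ∞ (T% X) x) :
    CMDiffAt ∞ (fun y ↦ S.η y (X y)) x := by
  have := contMDiffAt_inner hX (S.contMDiff_ξ x)
  simpa only [S.inner_ξ] using this

theorem η_mlieBracket (hX : MDiffAt (T% X) x) (hY : MDiffAt (T% Y) x) :
    S.η x (mlieBracket 𝓘(ℝ, E) X Y x) = mvfderiv 𝓘(ℝ, E) (fun y ↦ S.η y (Y y)) x (X x)
      - mvfderiv 𝓘(ℝ, E) (fun y ↦ S.η y (X y)) x (Y x) - 2 * inner ℝ (X x) (S.φ x (Y x)) := by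
  have h := S.dη_eq x X Y hX hY
  rw [dOneForm] at h
  linarith

theorem η_mlieBracket_ξ (hX : MDiffAt (T% X) x) :
    S.η x (mlieBracket 𝓘(ℝ, E) S.ξ X x) = mvfderiv 𝓘(ℝ, E) (fun y ↦ S.η y (X y)) x (S.ξ x) := by
  rw [S.η_mlieBracket S.mdifferentiableAt_ξ hX,
    mvfderiv_eq_zero_of_eventually_const (c := 1) (.of_forall S.η_ξ), S.inner_ξ_left, S.η_φ]
  ring

/-- In the Koszul formula with `ξ` in the middle slot, the terms involving η(X), η(Y) and η([X,Y])
form 2 dη(X,Y) = 2 g(X,φY), and the others form (L_ξ g)(X,Y). -/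
theorem inner_covDeriv_ξ (hX : MDiffAt (T% X) x) (hY : MDiffAt (T% Y) x) :
    inner ℝ (covDeriv X S.ξ x) (Y x) = inner ℝ (X x) (S.φ x (Y x))
      + (mvfderiv 𝓘(ℝ, E) (fun y ↦ inner ℝ (X y) (Y y)) x (S.ξ x)
        - inner ℝ (mlieBracket 𝓘(ℝ, E) S.ξ X x) (Y x)
        - inner ℝ (X x) (mlieBracket 𝓘(ℝ, E) S.ξ Y x)) / 2 := by
  have h1 : inner ℝ (covDeriv X S.ξ x) (Y x) = koszul X S.ξ Y x :=
    inner_koszulDerivative hX hY S.mdifferentiableAt_ξ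
  have h2 := S.η_mlieBracket hX hY
  simp only [koszul, S.inner_ξ_left, S.inner_ξ] at h1
  rw [mlieBracket_swap_apply (V := X) (W := S.ξ), inner_neg_left,
    real_inner_comm (X x) (mlieBracket 𝓘(ℝ, E) S.ξ Y x)] at h1
  linarith

/-- Both parts of ∇ξ vanish on `ξ`: g(ξ,φw) = 0, and (L_ξ g)(ξ,w) = (L_ξ η)(w) = 0. -/
theorem covDeriv_ξ_ξ (x : M) : covDeriv S.ξ S.ξ x = 0 := by
  refine ext_inner_right ℝ fun w ↦ ?_
  have hw := FiberBundle.mdifferentiableAt_extend 𝓘(ℝ, E) E w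
  have h := S.inner_covDeriv_ξ S.mdifferentiableAt_ξ hw
  simp only [S.inner_ξ_left, S.η_φ, S.η_mlieBracket_ξ hw, mlieBracket_self, Pi.zero_apply,
    inner_zero_left, FiberBundle.extend_apply_self] at h
  rw [h, inner_zero_left]
  ring

theorem inner_covDeriv_ξ_ξ (hX : MDiffAt (T% X) x) : inner ℝ (covDeriv X S.ξ x) (S.ξ x) = 0 := by
  have h := inner_covDeriv_add hX S.mdifferentiableAt_ξ S.mdifferentiableAt_ξ
  rw [mvfderiv_eq_zero_of_eventually_const (c := 1)
    (.of_forall fun y ↦ by rw [S.inner_ξ, S.η_ξ]), real_inner_comm] at h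
  rw [real_inner_comm]
  linarith

/-- The field `e` is smooth near `x` and is a unit field orthogonal to `ξ` there. -/
def IsAdaptedAt (e : (x : M) → TangentSpace 𝓘(ℝ, E) x) (x : M) : Prop :=
  ∀ᶠ y in 𝓝 x, CMDiffAt ∞ (T% e) y ∧ inner ℝ (e y) (e y) = (1 : ℝ) ∧ S.η y (e y) = 0

theorem exists_isAdaptedAt (hdim : Module.finrank ℝ E = 3) (x : M) : ∃ e, S.IsAdaptedAt e x := by
  obtain ⟨w, hw, hw0⟩ : ∃ w : TangentSpace 𝓘(ℝ, E) x, S.η x w = 0 ∧ w ≠ 0 := by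
    have h : Module.finrank ℝ ℝ < Module.finrank ℝ (TangentSpace 𝓘(ℝ, E) x) := by
      change Module.finrank ℝ ℝ < Module.finrank ℝ E
      rw [hdim, Module.finrank_self]
      norm_num
    obtain ⟨w, hw, hw0⟩ := Submodule.exists_mem_ne_zero_of_ne_bot
      (LinearMap.ker_ne_bot_of_finrank_lt (f := (S.η x).toLinearMap) h)
    exact ⟨w, hw, hw0⟩
  -- An extension smooth on a whole neighbourhood is required: `CMDiffAt ∞` at one point provides a
  -- neighbourhood for each finite order only, so it does not spread to nearby points. The field is
  -- then projected off `ξ` and normalised.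
  obtain ⟨s, hs, hsw⟩ := FiberBundle.exists_contMDiffOn_extend (k := ∞) 𝓘(ℝ, E) E w
  let W : (y : M) → TangentSpace 𝓘(ℝ, E) y := FiberBundle.extend E w
  let V : (y : M) → TangentSpace 𝓘(ℝ, E) y := W - (fun y ↦ S.η y (W y)) • S.ξ
  have hV : ∀ᶠ y in 𝓝 x, CMDiffAt ∞ (T% V) y := by
    filter_upwards [eventually_mem_nhds_iff.2 hs] with y hy
    have hW : CMDiffAt ∞ (T% W) y := hsw.contMDiffAt hy
    exact hW.sub_section ((S.contMDiffAt_η_apply hW).smul_section S.contMDiff_ξ.contMDiffAt)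
  have hVx : V x = w := by simp [V, W, hw]
  have hη (y) : S.η y (V y) = 0 := by simp [V, S.η_ξ]
  have hpos : ∀ᶠ y in 𝓝 x, 0 < (inner ℝ (V y) (V y) : ℝ) := by
    refine (contMDiffAt_inner hV.self_of_nhds hV.self_of_nhds).continuousAt.eventually_const_lt ?_
    change 0 < inner ℝ (V x) (V x)
    rw [hVx]
    exact real_inner_self_pos.2 hw0
  refine ⟨(fun y ↦ (√(inner ℝ (V y) (V y)))⁻¹) • V, ?_⟩
  filter_upwards [hV, hpos] with y h1 h2
  refine ⟨?_, ?_, by simp [hη]⟩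
  · refine ContMDiffAt.smul_section ?_ h1
    have h3 := (Real.contDiffAt_sqrt (n := ∞) h2.ne').inv (Real.sqrt_pos.2 h2).ne'
    exact h3.contMDiffAt.comp (f := fun y ↦ inner ℝ (V y) (V y)) y (contMDiffAt_inner h1 h1)
  · simp only [Pi.smul_apply', real_inner_smul_left, real_inner_smul_right]
    field_simp
    rw [Real.sq_sqrt h2.le]

namespace IsAdaptedAt

variable {S}

theorem eventually (he : S.IsAdaptedAt e x) : ∀ᶠ y in 𝓝 x, S.IsAdaptedAt e y :=
  eventually_eventually_nhds.2 he

theorem contMDiffAt (he : S.IsAdaptedAt e x) : CMDiffAt ∞ (T% e) x := he.self_of_nhds.1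

theorem contMDiffAt_φ (he : S.IsAdaptedAt e x) : CMDiffAt ∞ (T% (fun y ↦ S.φ y (e y))) x :=
  S.contMDiffAt_φ_apply he.contMDiffAt

theorem inner_self (he : S.IsAdaptedAt e x) : inner ℝ (e x) (e x) = (1 : ℝ) := he.self_of_nhds.2.1

theorem η_apply (he : S.IsAdaptedAt e x) : S.η x (e x) = 0 := he.self_of_nhds.2.2

theorem φ_φ (he : S.IsAdaptedAt e x) : S.φ x (S.φ x (e x)) = -e x := by
  rw [S.φ_φ, he.η_apply, zero_smul, add_zero]

theorem inner_φ_self (he : S.IsAdaptedAt e x) :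
    inner ℝ (S.φ x (e x)) (S.φ x (e x)) = (1 : ℝ) := by
  rw [S.inner_φ_φ, he.inner_self, he.η_apply]
  ring

theorem inner_φ (u : TangentSpace 𝓘(ℝ, E) x) : inner ℝ u (S.φ x u) = (0 : ℝ) := by
  have h := S.inner_φ_left u u
  rw [real_inner_comm] at h
  linarith

/-- The frame `(e, φ e, ξ)`. -/
def frame (_ : S.IsAdaptedAt e x) : Fin 3 → (x : M) → TangentSpace 𝓘(ℝ, E) x :=
  ![e, fun y ↦ S.φ y (e y), S.ξ]

theorem orthonormal (he : S.IsAdaptedAt e x) :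
    Orthonormal ℝ ![e x, S.φ x (e x), S.ξ x] := by
  have h1 := he.inner_self
  have h2 := he.inner_φ_self
  have h3 := inner_φ (S := S) (e x)
  have h4 := he.η_apply
  rw [orthonormal_iff_ite]
  intro i j
  fin_cases i <;> fin_cases j <;>
    simp [-inner_self_eq_norm_sq_to_K, h1, h2, h3, h4, S.inner_ξ,
      S.inner_ξ_left, S.η_φ, S.η_ξ, S.inner_φ_left]

/-- The orthonormal basis `(e, φ e, ξ)` of `T_x M`. -/
def basis (hdim : Module.finrank ℝ E = 3) (he : S.IsAdaptedAt e x) :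
    OrthonormalBasis (Fin 3) ℝ (TangentSpace 𝓘(ℝ, E) x) :=
  OrthonormalBasis.mk he.orthonormal
    (he.orthonormal.linearIndependent.span_eq_top_of_card_eq_finrank'
      ((Fintype.card_fin 3).trans hdim.symm)).ge

theorem basis_zero (hdim : Module.finrank ℝ E = 3) (he : S.IsAdaptedAt e x) : he.basis hdim 0 = e x := by simp [basis]

theorem basis_one (hdim : Module.finrank ℝ E = 3) (he : S.IsAdaptedAt e x) : he.basis hdim 1 = S.φ x (e x) := by simp [basis]

theorem basis_two (hdim : Module.finrank ℝ E = 3) (he : S.IsAdaptedAt e x) : he.basis hdim 2 = S.ξ x := by simp [basis]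

theorem isOrthonormalFrameAt (hdim : Module.finrank ℝ E = 3) (he : S.IsAdaptedAt e x) : IsOrthonormalFrameAt he.frame x where
  contMDiffAt i := by
    fin_cases i
    exacts [he.contMDiffAt, he.contMDiffAt_φ, S.contMDiff_ξ.contMDiffAt]
  exists_basis := he.eventually.mono fun y hy ↦ ⟨hy.basis hdim, fun i ↦ by
    fin_cases i
    exacts [hy.basis_zero hdim, hy.basis_one hdim, hy.basis_two hdim]⟩

theorem inner_eq (hdim : Module.finrank ℝ E = 3) (he : S.IsAdaptedAt e x) (u v : TangentSpace 𝓘(ℝ, E) x) :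
    inner ℝ u v = inner ℝ u (e x) * inner ℝ v (e x)
      + inner ℝ u (S.φ x (e x)) * inner ℝ v (S.φ x (e x)) + S.η x u * S.η x v := by
  rw [← (he.basis hdim).sum_inner_mul_inner, Fin.sum_univ_three, basis_zero, basis_one, basis_two,
    real_inner_comm v, real_inner_comm v, S.inner_ξ, S.inner_ξ_left]

theorem eq_sum (hdim : Module.finrank ℝ E = 3) (he : S.IsAdaptedAt e x) (u : TangentSpace 𝓘(ℝ, E) x) :
    u = inner ℝ u (e x) • e x + inner ℝ u (S.φ x (e x)) • S.φ x (e x) + S.η x u • S.ξ x := by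
  conv_lhs => rw [← (he.basis hdim).sum_repr' u, Fin.sum_univ_three, basis_zero, basis_one,
    basis_two, real_inner_comm u, real_inner_comm u, S.inner_ξ_left]

theorem η_mlieBracket_ξ_self (he : S.IsAdaptedAt e x) :
    S.η x (mlieBracket 𝓘(ℝ, E) S.ξ e x) = 0 := by
  rw [S.η_mlieBracket_ξ (he.contMDiffAt.mdifferentiableAt (by simp)),
    mvfderiv_eq_zero_of_eventually_const (c := 0) (he.eventually.mono fun y hy ↦ hy.η_apply)]

theorem η_mlieBracket_ξ_φ (he : S.IsAdaptedAt e x) :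
    S.η x (mlieBracket 𝓘(ℝ, E) S.ξ (fun y ↦ S.φ y (e y)) x) = 0 := by
  rw [S.η_mlieBracket_ξ (he.contMDiffAt_φ.mdifferentiableAt (by simp)),
    mvfderiv_eq_zero_of_eventually_const (c := 0) (.of_forall fun y ↦ S.η_φ y _)]

theorem η_mlieBracket_self_φ (he : S.IsAdaptedAt e x) :
    S.η x (mlieBracket 𝓘(ℝ, E) e (fun y ↦ S.φ y (e y)) x) = 2 := by
  rw [S.η_mlieBracket (he.contMDiffAt.mdifferentiableAt (by simp))
    (he.contMDiffAt_φ.mdifferentiableAt (by simp)),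
    mvfderiv_eq_zero_of_eventually_const (c := 0) (.of_forall fun y ↦ S.η_φ y _),
    mvfderiv_eq_zero_of_eventually_const (c := 0) (he.eventually.mono fun y hy ↦ hy.η_apply),
    he.φ_φ, inner_neg_right, he.inner_self]
  ring

/-- `ξ` is divergence free. -/
theorem inner_mlieBracket_add (he : S.IsAdaptedAt e x) :
    inner ℝ (mlieBracket 𝓘(ℝ, E) S.ξ e x) (e x)
      + inner ℝ (mlieBracket 𝓘(ℝ, E) S.ξ (fun y ↦ S.φ y (e y)) x) (S.φ x (e x)) = 0 := by
  have := isManifold_minSmoothness_three (I := 𝓘(ℝ, E)) (M := M)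
  have h2 : (minSmoothness ℝ 2) ≤ (∞ : ℕ∞ω) := by
    simp only [minSmoothness_of_isRCLikeNormedField]; exact ENat.LEInfty.out
  have hξ : CMDiffAt ∞ (T% S.ξ) x := S.contMDiff_ξ.contMDiffAt
  have h := leibniz_identity_mlieBracket_apply (hξ.of_le h2) (he.contMDiffAt.of_le h2)
    (he.contMDiffAt_φ.of_le h2)
  have d1 := he.contMDiffAt.mdifferentiableAt (by simp)
  have d2 := he.contMDiffAt_φ.mdifferentiableAt (by simp)
  have d3 := (contMDiffAt_mlieBracket hξ he.contMDiffAt).mdifferentiableAt (by simp)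
  have d4 := (contMDiffAt_mlieBracket hξ he.contMDiffAt_φ).mdifferentiableAt (by simp)
  have d5 := (contMDiffAt_mlieBracket he.contMDiffAt he.contMDiffAt_φ).mdifferentiableAt (by simp)
  -- Under η the left side [ξ,[e,φe]] becomes ξ(2) = 0. On the right, all derivative terms vanish
  -- because η([ξ,e]), η([ξ,φe]), η(e) and η(φe) are zero near x; dη = g(·,φ·) turns what is left
  -- into twice the claimed sum.
  replace h := congrArg (S.η x) h
  rw [map_add, S.η_mlieBracket_ξ d5, S.η_mlieBracket d3 d2, S.η_mlieBracket d1 d4,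
    mvfderiv_eq_zero_of_eventually_const (he.eventually.mono fun y hy ↦ hy.η_mlieBracket_self_φ),
    mvfderiv_eq_zero_of_eventually_const (he.eventually.mono fun y hy ↦ hy.η_mlieBracket_ξ_self),
    mvfderiv_eq_zero_of_eventually_const (he.eventually.mono fun y hy ↦ hy.η_mlieBracket_ξ_φ),
    mvfderiv_eq_zero_of_eventually_const (.of_forall fun y ↦ S.η_φ y (e y)),
    mvfderiv_eq_zero_of_eventually_const (he.eventually.mono fun y hy ↦ hy.η_apply),
    he.φ_φ, inner_neg_right, real_inner_comm _ (e x), S.inner_φ_left] at h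
  linarith

end IsAdaptedAt

/-- The two terms (ξf) φX cancel. This allows h to be evaluated on the frame fields. -/
theorem smoothTensorialAt_lieDerivEndo (x : M) :
    SmoothTensorialAt (fun X ↦ lieDerivEndo S.ξ S.φ X x) x where
  smul {f X} hf hX := by
    have d1 := hf.mdifferentiableAt (by simp)
    have d2 := hX.mdifferentiableAt (by simp)
    have d3 := (S.contMDiffAt_φ_apply hX).mdifferentiableAt (by simp)
    have h : (fun y ↦ S.φ y ((f • X) y)) = f • fun y ↦ S.φ y (X y) := by
      funext y; simp
    simp only [lieDerivEndo, h, mlieBracket_smul_right d1 d2, mlieBracket_smul_right d1 d3,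
      map_add, map_smul]
    module
  add {X X'} hX hX' := by
    have h : (fun y ↦ S.φ y ((X + X') y)) = (fun y ↦ S.φ y (X y)) + fun y ↦ S.φ y (X' y) := by
      funext y; simp
    simp only [lieDerivEndo, h, mlieBracket_add_right (hX.mdifferentiableAt (by simp))
      (hX'.mdifferentiableAt (by simp)), mlieBracket_add_right
      ((S.contMDiffAt_φ_apply hX).mdifferentiableAt (by simp))
      ((S.contMDiffAt_φ_apply hX').mdifferentiableAt (by simp)), map_add]
    abel

theorem h_apply (hX : CMDiffAt ∞ (T% X) x) :
    S.h x (X x) = (1 / 2 : ℝ) • lieDerivEndo S.ξ S.φ X x := by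
  rw [h, (S.smoothTensorialAt_lieDerivEndo x).apply_eq_extend hX]

/-- The tensor `h` as a linear map. -/
def hLinear (x : M) : TangentSpace 𝓘(ℝ, E) x →ₗ[ℝ] TangentSpace 𝓘(ℝ, E) x where
  toFun := S.h x
  map_add' u v := by
    simp only [h, (S.smoothTensorialAt_lieDerivEndo x).extend_add, smul_add]
  map_smul' a u := by
    simp only [h, (S.smoothTensorialAt_lieDerivEndo x).extend_smul, RingHom.id_apply]
    rw [smul_comm]

theorem hLinear_apply (u : TangentSpace 𝓘(ℝ, E) x) : S.hLinear x u = S.h x u := rfl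

theorem h_ξ (x : M) : S.h x (S.ξ x) = 0 := by
  rw [S.h_apply S.contMDiff_ξ.contMDiffAt, lieDerivEndo, mlieBracket_self]
  have h : (fun y ↦ S.φ y (S.ξ y)) = 0 := funext S.φ_ξ
  simp [h]

end ContactMetricStructure₃

end ContactMetric

/-! ### Ricci curvature of ξ and the scalar curvature identity. -/

section ContactCurvature

variable {E : Type*} [NormedAddCommGroup E] [NormedSpace ℝ E] [FiniteDimensional ℝ E]
  {M : Type*} [TopologicalSpace M] [ChartedSpace E M] [IsManifold 𝓘(ℝ, E) ∞ M]
  [RiemannianBundle (fun x : M ↦ TangentSpace 𝓘(ℝ, E) x)]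
  [IsContMDiffRiemannianBundle 𝓘(ℝ, E) ∞ E (fun x : M ↦ TangentSpace 𝓘(ℝ, E) x)]

namespace ContactMetricStructure₃

variable {S : ContactMetricStructure₃ E M} {x : M} {X Y e : (x : M) → TangentSpace 𝓘(ℝ, E) x}

namespace IsAdaptedAt

theorem mlieBracket_ξ_φ_φ (he : S.IsAdaptedAt e x) :
    mlieBracket 𝓘(ℝ, E) S.ξ (fun y ↦ S.φ y (S.φ y (e y))) x = -mlieBracket 𝓘(ℝ, E) S.ξ e x := by
  have h : mlieBracket 𝓘(ℝ, E) S.ξ ((-1 : ℝ) • e) x = (-1 : ℝ) • mlieBracket 𝓘(ℝ, E) S.ξ e x :=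
    mlieBracket_const_smul_right (he.contMDiffAt.mdifferentiableAt (by simp))
  rw [← neg_one_smul ℝ (mlieBracket 𝓘(ℝ, E) S.ξ e x), ← h]
  exact mlieBracket_congr (.of_forall fun _ ↦ rfl)
    (he.eventually.mono fun y hy ↦ by simp [hy.φ_φ])

/-- The components are those of ½([ξ,φe] - φ[ξ,e]); `inner_mlieBracket_add` merges the two
contributions along φe. Together with `h_φ` this exhibits h as symmetric and trace-free on the
contact plane. -/
theorem h_self (hdim : Module.finrank ℝ E = 3) (he : S.IsAdaptedAt e x) :
    S.h x (e x) =
      ((inner ℝ (mlieBracket 𝓘(ℝ, E) S.ξ (fun y ↦ S.φ y (e y)) x) (e x)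
        + inner ℝ (mlieBracket 𝓘(ℝ, E) S.ξ e x) (S.φ x (e x))) / 2) • e x
      - inner ℝ (mlieBracket 𝓘(ℝ, E) S.ξ e x) (e x) • S.φ x (e x) := by
  rw [he.eq_sum hdim (S.h x (e x)), S.h_apply he.contMDiffAt, lieDerivEndo]
  simp only [real_inner_smul_left, inner_sub_left, map_smul, map_sub, he.η_mlieBracket_ξ_φ,
    S.η_φ, S.inner_φ_left, he.φ_φ, inner_neg_right]
  have := he.inner_mlieBracket_add
  rw [← eq_neg_iff_add_eq_zero] at this
  rw [this]
  module

theorem h_φ (hdim : Module.finrank ℝ E = 3) (he : S.IsAdaptedAt e x) :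
    S.h x (S.φ x (e x)) =
      -inner ℝ (mlieBracket 𝓘(ℝ, E) S.ξ e x) (e x) • e x
      - ((inner ℝ (mlieBracket 𝓘(ℝ, E) S.ξ (fun y ↦ S.φ y (e y)) x) (e x)
        + inner ℝ (mlieBracket 𝓘(ℝ, E) S.ξ e x) (S.φ x (e x))) / 2) • S.φ x (e x) := by
  rw [he.eq_sum hdim (S.h x (S.φ x (e x))), S.h_apply he.contMDiffAt_φ, lieDerivEndo,
    he.mlieBracket_ξ_φ_φ]
  simp only [real_inner_smul_left, inner_sub_left, map_smul, map_sub, map_neg, inner_neg_left,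
    he.η_mlieBracket_ξ_self, S.η_φ, S.inner_φ_left, he.φ_φ, inner_neg_right]
  have := he.inner_mlieBracket_add
  rw [← eq_neg_iff_add_eq_zero] at this
  rw [this]
  module

theorem traceHSq_eq (hdim : Module.finrank ℝ E = 3) (he : S.IsAdaptedAt e x) :
    S.traceHSq x =
      (inner ℝ (mlieBracket 𝓘(ℝ, E) S.ξ (fun y ↦ S.φ y (e y)) x) (e x)
        + inner ℝ (mlieBracket 𝓘(ℝ, E) S.ξ e x) (S.φ x (e x))) ^ 2 / 2
      + 2 * inner ℝ (mlieBracket 𝓘(ℝ, E) S.ξ e x) (e x) ^ 2 := by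
  have h : S.traceHSq x = _ := tangentTrace_eq_sum (S.hLinear x ∘ₗ S.hLinear x) (he.basis hdim)
  rw [h, Fin.sum_univ_three, he.basis_zero, he.basis_one, he.basis_two]
  simp only [LinearMap.comp_apply]
  rw [S.hLinear_apply (S.ξ x), S.h_ξ, S.hLinear_apply (e x), S.hLinear_apply (S.φ x (e x)),
    he.h_self hdim, he.h_φ hdim]
  simp only [map_sub, map_smul, map_zero]
  simp only [S.hLinear_apply, he.h_self hdim, he.h_φ hdim]
  simp only [inner_sub_left, real_inner_smul_left, he.inner_self, he.inner_φ_self,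
    S.inner_φ_left, inner_φ, inner_zero_left, neg_zero]
  ring

theorem inner_covDeriv_self (he : S.IsAdaptedAt e x) (hX : MDiffAt (T% X) x) :
    inner ℝ (covDeriv X e x) (e x) = 0 := by
  have d := he.contMDiffAt.mdifferentiableAt (by simp)
  have h := inner_covDeriv_add hX d d
  rw [mvfderiv_eq_zero_of_eventually_const (he.eventually.mono fun y hy ↦ hy.inner_self),
    real_inner_comm] at h
  rw [real_inner_comm]
  linarith

theorem inner_covDeriv_φ (he : S.IsAdaptedAt e x) (hX : MDiffAt (T% X) x) :
    inner ℝ (covDeriv X (fun y ↦ S.φ y (e y)) x) (S.φ x (e x)) = 0 := by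
  have d := he.contMDiffAt_φ.mdifferentiableAt (by simp)
  have h := inner_covDeriv_add hX d d
  rw [mvfderiv_eq_zero_of_eventually_const (he.eventually.mono fun y hy ↦ hy.inner_φ_self),
    real_inner_comm] at h
  rw [real_inner_comm]
  linarith

theorem inner_covDeriv_φ_self (he : S.IsAdaptedAt e x) (hX : MDiffAt (T% X) x) :
    inner ℝ (covDeriv X (fun y ↦ S.φ y (e y)) x) (e x)
      = -inner ℝ (covDeriv X e x) (S.φ x (e x)) := by
  have d := he.contMDiffAt_φ.mdifferentiableAt (by simp)
  have d' := he.contMDiffAt.mdifferentiableAt (by simp)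
  have h := inner_covDeriv_add hX d' d
  rw [mvfderiv_eq_zero_of_eventually_const (c := 0) (.of_forall fun y ↦ inner_φ _),
    real_inner_comm _ (e x)] at h
  linarith

/-- This and the next three lemmas are the entries of ∇ξ on the contact plane, that is of -φ - φh.
-/
theorem inner_covDeriv_ξ_self (he : S.IsAdaptedAt e x) :
    inner ℝ (covDeriv e S.ξ x) (e x) = -inner ℝ (mlieBracket 𝓘(ℝ, E) S.ξ e x) (e x) := by
  have d := he.contMDiffAt.mdifferentiableAt (by simp)
  rw [S.inner_covDeriv_ξ d d, mvfderiv_eq_zero_of_eventually_const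
    (he.eventually.mono fun y hy ↦ hy.inner_self), inner_φ,
    real_inner_comm _ (e x)]
  ring

theorem inner_covDeriv_φ_ξ_φ (he : S.IsAdaptedAt e x) :
    inner ℝ (covDeriv (fun y ↦ S.φ y (e y)) S.ξ x) (S.φ x (e x))
      = inner ℝ (mlieBracket 𝓘(ℝ, E) S.ξ e x) (e x) := by
  have d := he.contMDiffAt_φ.mdifferentiableAt (by simp)
  have h := he.inner_mlieBracket_add
  rw [S.inner_covDeriv_ξ d d, mvfderiv_eq_zero_of_eventually_const
    (he.eventually.mono fun y hy ↦ hy.inner_φ_self), inner_φ,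
    real_inner_comm _ (S.φ x (e x))]
  linarith

theorem inner_covDeriv_ξ_φ (he : S.IsAdaptedAt e x) :
    inner ℝ (covDeriv e S.ξ x) (S.φ x (e x)) = -1
      - (inner ℝ (mlieBracket 𝓘(ℝ, E) S.ξ (fun y ↦ S.φ y (e y)) x) (e x)
        + inner ℝ (mlieBracket 𝓘(ℝ, E) S.ξ e x) (S.φ x (e x))) / 2 := by
  have d := he.contMDiffAt_φ.mdifferentiableAt (by simp)
  have d' := he.contMDiffAt.mdifferentiableAt (by simp)
  rw [S.inner_covDeriv_ξ d' d, mvfderiv_eq_zero_of_eventually_const (c := 0)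
    (.of_forall fun y ↦ inner_φ _), real_inner_comm _ (e x), he.φ_φ, inner_neg_left, he.inner_self,
    real_inner_comm _ (e x)]
  ring

theorem inner_covDeriv_φ_ξ_self (he : S.IsAdaptedAt e x) :
    inner ℝ (covDeriv (fun y ↦ S.φ y (e y)) S.ξ x) (e x) = 1
      - (inner ℝ (mlieBracket 𝓘(ℝ, E) S.ξ (fun y ↦ S.φ y (e y)) x) (e x)
        + inner ℝ (mlieBracket 𝓘(ℝ, E) S.ξ e x) (S.φ x (e x))) / 2 := by
  have d := he.contMDiffAt_φ.mdifferentiableAt (by simp)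
  have d' := he.contMDiffAt.mdifferentiableAt (by simp)
  rw [S.inner_covDeriv_ξ d d', mvfderiv_eq_zero_of_eventually_const (c := 0)
    (.of_forall fun y ↦ by rw [real_inner_comm, inner_φ]), he.inner_φ_self,
    real_inner_comm _ (S.φ x (e x))]
  ring

theorem inner_covDeriv_self_φ (he : S.IsAdaptedAt e x) :
    inner ℝ (covDeriv S.ξ e x) (S.φ x (e x)) =
      inner ℝ (mlieBracket 𝓘(ℝ, E) S.ξ e x) (S.φ x (e x))
        + inner ℝ (covDeriv e S.ξ x) (S.φ x (e x)) := by
  rw [← covDeriv_sub_covDeriv S.mdifferentiableAt_ξ (he.contMDiffAt.mdifferentiableAt (by simp)),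
    inner_sub_left]
  ring

/-- Since ∇_ξ ξ vanishes as a field, R(X,ξ)ξ = -∇_ξ ∇_X ξ - ∇_[X,ξ] ξ. The first term is rewritten
by metric compatibility; in the second, [ξ,X] has no ξ-component and is expanded in e, φe. -/
theorem inner_curvatureField_ξ (hdim : Module.finrank ℝ E = 3) (he : S.IsAdaptedAt e x)
    (hX : CMDiffAt ∞ (T% X) x) (hη : S.η x (mlieBracket 𝓘(ℝ, E) S.ξ X x) = 0) :
    inner ℝ (curvatureField X S.ξ S.ξ x) (X x) =
      - mvfderiv 𝓘(ℝ, E) (fun y ↦ inner ℝ (covDeriv X S.ξ y) (X y)) x (S.ξ x)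
      + inner ℝ (covDeriv X S.ξ x) (covDeriv S.ξ X x)
      + inner ℝ (mlieBracket 𝓘(ℝ, E) S.ξ X x) (e x) * inner ℝ (covDeriv e S.ξ x) (X x)
      + inner ℝ (mlieBracket 𝓘(ℝ, E) S.ξ X x) (S.φ x (e x))
        * inner ℝ (covDeriv (fun y ↦ S.φ y (e y)) S.ξ x) (X x) := by
  have hξ : CMDiffAt ∞ (T% S.ξ) x := S.contMDiff_ξ.contMDiffAt
  have d := hX.mdifferentiableAt (by simp)
  have d' := ((he.isOrthonormalFrameAt hdim).contMDiffAt_covDeriv hX hξ).mdifferentiableAt (by simp)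
  have h0 : covDeriv X (covDeriv S.ξ S.ξ) x = 0 := by
    rw [show covDeriv S.ξ S.ξ = 0 from funext S.covDeriv_ξ_ξ, covDeriv]
    simp
  have h1 := inner_covDeriv_add S.mdifferentiableAt_ξ d' d
  have h2 : covDeriv (mlieBracket 𝓘(ℝ, E) X S.ξ) S.ξ x =
      -(inner ℝ (mlieBracket 𝓘(ℝ, E) S.ξ X x) (e x) • covDeriv e S.ξ x
        + inner ℝ (mlieBracket 𝓘(ℝ, E) S.ξ X x) (S.φ x (e x))
          • covDeriv (fun y ↦ S.φ y (e y)) S.ξ x) := by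
    simp only [covDeriv]
    rw [mlieBracket_swap_apply, map_neg]
    conv_lhs => rw [he.eq_sum hdim (mlieBracket 𝓘(ℝ, E) S.ξ X x), hη]
    simp
  rw [curvatureField_eq, h0, h2]
  simp only [inner_sub_left, inner_neg_left, inner_add_left, real_inner_smul_left, inner_zero_left]
  linarith

/-- The Ricci curvature of `ξ` is `2 - tr h²`. -/
theorem inner_curvatureField_add (hdim : Module.finrank ℝ E = 3) (he : S.IsAdaptedAt e x) :
    inner ℝ (curvatureField e S.ξ S.ξ x) (e x)
      + inner ℝ (curvatureField (fun y ↦ S.φ y (e y)) S.ξ S.ξ x) (S.φ x (e x))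
      = 2 - S.traceHSq x := by
  have hξ : CMDiffAt ∞ (T% S.ξ) x := S.contMDiff_ξ.contMDiffAt
  have hf := he.isOrthonormalFrameAt hdim
  have d := he.contMDiffAt.mdifferentiableAt (by simp)
  have d' := he.contMDiffAt_φ.mdifferentiableAt (by simp)
  have c := (hf.contMDiffAt_covDeriv he.contMDiffAt hξ).mdifferentiableAt (by simp)
  have c' := (hf.contMDiffAt_covDeriv he.contMDiffAt_φ hξ).mdifferentiableAt (by simp)
  -- The only terms of the Ricci curvature that differentiate the entries of ∇ξ. Their sum is ξ(div
  -- ξ), and div ξ = 0 near x, so the individual derivatives are never needed.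
  have hdiv : mvfderiv 𝓘(ℝ, E) (fun y ↦ inner ℝ (covDeriv e S.ξ y) (e y)) x (S.ξ x)
      + mvfderiv 𝓘(ℝ, E) (fun y ↦ inner ℝ (covDeriv (fun y ↦ S.φ y (e y)) S.ξ y) (S.φ y (e y)))
        x (S.ξ x) = 0 := by
    rw [← add_apply, ← mvfderiv_fun_add (mdifferentiableAt_inner c d)
      (mdifferentiableAt_inner c' d')]
    refine mvfderiv_eq_zero_of_eventually_const (c := 0) (he.eventually.mono fun y hy ↦ ?_) _
    rw [hy.inner_covDeriv_ξ_self, hy.inner_covDeriv_φ_ξ_φ]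
    ring
  have h1 := he.inner_curvatureField_ξ hdim he.contMDiffAt he.η_mlieBracket_ξ_self
  have h2 := he.inner_curvatureField_ξ hdim he.contMDiffAt_φ he.η_mlieBracket_ξ_φ
  have hd := he.inner_mlieBracket_add
  have s := S.mdifferentiableAt_ξ (x := x)
  rw [he.inner_eq hdim (covDeriv e S.ξ x), he.inner_covDeriv_self s,
    he.inner_covDeriv_self_φ, ← S.inner_ξ x (covDeriv e S.ξ x), S.inner_covDeriv_ξ_ξ d] at h1
  rw [he.inner_eq hdim (covDeriv _ S.ξ x), he.inner_covDeriv_φ s, he.inner_covDeriv_φ_self s,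
    he.inner_covDeriv_self_φ, ← S.inner_ξ x (covDeriv _ S.ξ x), S.inner_covDeriv_ξ_ξ d'] at h2
  rw [he.inner_covDeriv_ξ_φ, he.inner_covDeriv_φ_ξ_self, he.inner_covDeriv_ξ_self] at h1
  rw [he.inner_covDeriv_ξ_φ, he.inner_covDeriv_φ_ξ_self, he.inner_covDeriv_φ_ξ_φ,
    eq_neg_of_add_eq_zero_right hd] at h2
  rw [he.traceHSq_eq hdim, h1, h2]
  linear_combination -hdiv

theorem scalarCurvature_eq (hdim : Module.finrank ℝ E = 3) (he : S.IsAdaptedAt e x) :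
    scalarCurvature E x =
      ∑ i, ∑ j, inner ℝ (curvature x (he.basis hdim j) (he.basis hdim i) (he.basis hdim i))
        (he.basis hdim j) := by
  let c := (he.isOrthonormalFrameAt hdim).curvatureLinear
  let b := he.basis hdim
  let B : TangentSpace 𝓘(ℝ, E) x →ₗ[ℝ] TangentSpace 𝓘(ℝ, E) x →ₗ[ℝ] ℝ :=
    LinearMap.mk₂ ℝ (fun u v ↦ ∑ j, inner ℝ (c (b j) u v) (b j))
      (fun u u' v ↦ by simp [inner_add_left, Finset.sum_add_distrib])
      (fun a u v ↦ by simp [real_inner_smul_left, Finset.mul_sum])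
      (fun u v v' ↦ by simp [inner_add_left, Finset.sum_add_distrib])
      (fun a u v ↦ by simp [real_inner_smul_left, Finset.mul_sum])
  have h : ricci x = fun u v ↦ B u v := by
    funext u v
    exact tangentTrace_eq_sum ((c.flip u).flip v) b
  rw [scalarCurvature, h, tangentTrace_raiseIndex B b]
  rfl

theorem starScalarCurvature_eq (hdim : Module.finrank ℝ E = 3) (he : S.IsAdaptedAt e x) :
    S.starScalarCurvature x =
      ∑ i, (1 / 2) * ∑ j, inner ℝ (curvature x (he.basis hdim i) (S.φ x (he.basis hdim i))
        (S.φ x (he.basis hdim j))) (he.basis hdim j) := by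
  let c := (he.isOrthonormalFrameAt hdim).curvatureLinear
  let b := he.basis hdim
  let B : TangentSpace 𝓘(ℝ, E) x →ₗ[ℝ] TangentSpace 𝓘(ℝ, E) x →ₗ[ℝ] ℝ :=
    LinearMap.mk₂ ℝ (fun u v ↦ (1 / 2) * ∑ j, inner ℝ (c u (S.φ x v) (S.φ x (b j))) (b j))
      (fun u u' v ↦ by simp [inner_add_left, Finset.sum_add_distrib, mul_add])
      (fun a u v ↦ by simp [real_inner_smul_left, ← Finset.mul_sum, mul_left_comm])
      (fun u v v' ↦ by simp [inner_add_left, Finset.sum_add_distrib, mul_add])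
      (fun a u v ↦ by simp [real_inner_smul_left, ← Finset.mul_sum, mul_left_comm])
  have h : S.starRicci x = fun u v ↦ B u v := by
    funext u v
    exact congrArg (1 / 2 * ·) (tangentTrace_eq_sum (c u (S.φ x v) ∘ₗ (S.φ x).toLinearMap) b)
  rw [starScalarCurvature, h, tangentTrace_raiseIndex B b]
  rfl

/-- As φ exchanges e and φe up to sign and kills ξ, the double sum for τ* reduces to g(R(e,φe)φe,e)
- g(R(e,φe)e,φe), which also occurs in τ. The other terms of τ amount to 2 Ric(ξ,ξ). -/
theorem starScalarCurvature_sub_scalarCurvature (hdim : Module.finrank ℝ E = 3)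
    (he : S.IsAdaptedAt e x) :
    S.starScalarCurvature x - scalarCurvature E x + 4 = 2 * S.traceHSq x := by
  have hξ : CMDiffAt ∞ (T% S.ξ) x := S.contMDiff_ξ.contMDiffAt
  have hf := he.isOrthonormalFrameAt hdim
  have swap (u v w : TangentSpace 𝓘(ℝ, E) x) : curvature x u v w = -curvature x v u w :=
    curvatureField_swap _ _ _ _
  have diag (u w : TangentSpace 𝓘(ℝ, E) x) : curvature x u u w = 0 := by
    have h := swap u u w
    rw [eq_neg_iff_add_eq_zero, ← two_smul ℝ] at h
    exact (smul_eq_zero.1 h).resolve_left two_ne_zero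
  have zero₂ (u w : TangentSpace 𝓘(ℝ, E) x) : curvature x u 0 w = 0 := by
    rw [← hf.curvatureLinear_apply]; simp
  have zero₃ (u w : TangentSpace 𝓘(ℝ, E) x) : curvature x u w 0 = 0 :=
    (hf.curvatureLinear u w).map_zero
  have neg₂ (u v w : TangentSpace 𝓘(ℝ, E) x) : curvature x u (-v) w = -curvature x u v w := by
    simp only [← hf.curvatureLinear_apply]; simp
  have neg₃ (u v w : TangentSpace 𝓘(ℝ, E) x) : curvature x u v (-w) = -curvature x u v w :=
    (hf.curvatureLinear u v).map_neg w
  have h := he.inner_curvatureField_add hdim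
  -- Skew-symmetry in the last two slots is needed only for the planes containing ξ, to identify
  -- g(R(ξ,e)e,ξ) with g(R(e,ξ)ξ,e), and likewise for φe.
  have h1 := hf.inner_curvatureField_eq_neg he.contMDiffAt hξ hξ he.contMDiffAt (c := 0)
    (he.eventually.mono fun y hy ↦ by rw [S.inner_ξ_left, hy.η_apply])
  have h2 := hf.inner_curvatureField_eq_neg he.contMDiffAt_φ hξ hξ he.contMDiffAt_φ (c := 0)
    (.of_forall fun y ↦ by rw [S.inner_ξ_left, S.η_φ])
  simp only [← hf.curvature_apply he.contMDiffAt hξ hξ, ← hf.curvature_apply he.contMDiffAt_φ hξ hξ,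
    ← hf.curvature_apply he.contMDiffAt hξ he.contMDiffAt,
    ← hf.curvature_apply he.contMDiffAt_φ hξ he.contMDiffAt_φ] at h h1 h2
  rw [he.starScalarCurvature_eq hdim, he.scalarCurvature_eq hdim]
  simp only [Fin.sum_univ_three, he.basis_zero, he.basis_one, he.basis_two, he.φ_φ, S.φ_ξ, diag,
    zero₂, zero₃, neg₂, neg₃, inner_zero_left, inner_neg_left]
  rw [swap (S.ξ x) (e x), swap (S.ξ x) (S.φ x (e x)), swap (S.φ x (e x)) (e x) (S.φ x (e x)),
    swap (S.φ x (e x)) (e x) (e x)]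
  simp only [inner_neg_left]
  linarith

end IsAdaptedAt

end ContactMetricStructure₃

end ContactCurvature

/-! ### Vector fields as derivations and brackets of related fields. -/

section Related

variable {E : Type*} [NormedAddCommGroup E] [NormedSpace ℝ E]
  {H : Type*} [TopologicalSpace H] {I : ModelWithCorners ℝ E H}
  {M : Type*} [TopologicalSpace M] [ChartedSpace H M] [IsManifold I ∞ M]
  {E' : Type*} [NormedAddCommGroup E'] [NormedSpace ℝ E']
  {H' : Type*} [TopologicalSpace H'] {I' : ModelWithCorners ℝ E' H'}
  {N : Type*} [TopologicalSpace N] [ChartedSpace H' N] [IsManifold I' ∞ N]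

/-- Cancel the factor Z from `mvfderiv_mlieBracket_smul` by choosing Z nonzero at x; if the tangent
space is zero, both sides vanish. -/
theorem mvfderiv_mlieBracket [CompleteSpace E] {X Y : (x : M) → TangentSpace I x} {f : M → ℝ}
    {x : M} (hX : CMDiffAt ∞ (T% X) x) (hY : CMDiffAt ∞ (T% Y) x) (hf : CMDiffAt ∞ f x) :
    mvfderiv I f x (mlieBracket I X Y x) =
      mvfderiv I (fun y ↦ mvfderiv I f y (Y y)) x (X x)
        - mvfderiv I (fun y ↦ mvfderiv I f y (X y)) x (Y x) := by
  by_cases h : ∃ z : TangentSpace I x, z ≠ 0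
  · obtain ⟨z, hz⟩ := h
    have h := mvfderiv_mlieBracket_smul hX hY
      (FiberBundle.contMDiffAt_extend (k := ∞) I E z) hf
    rw [FiberBundle.extend_apply_self] at h
    exact smul_left_injective ℝ hz h
  · push Not at h
    rw [h (mlieBracket I X Y x), h (X x), h (Y x)]
    simp

/-- Test functions of the form L ∘ chart, with L a continuous linear functional, already separate
tangent vectors. -/
theorem eq_of_mvfderiv_eq {x : M} {v w : TangentSpace I x}
    (h : ∀ f : M → ℝ, CMDiffAt ∞ f x → mvfderiv I f x v = mvfderiv I f x w) : v = w := by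
  refine (isInvertible_mfderiv_extChartAt (I := I) (mem_extChartAt_source x)).injective ?_
  refine (SeparatingDual.eq_iff_forall_dual_eq (R := ℝ) (V := E)).2 fun L ↦ ?_
  have hc : CMDiffAt ∞ (extChartAt I x) x := contMDiffAt_extChartAt
  have hL : ContMDiff 𝓘(ℝ, E) 𝓘(ℝ, ℝ) ∞ L := L.contMDiff
  have h1 := h (fun y ↦ L (extChartAt I x y)) (hL.contMDiffAt.comp x hc)
  have h2 (u : TangentSpace I x) : mvfderiv I (fun y ↦ L (extChartAt I x y)) x u
      = L (mfderiv I 𝓘(ℝ, E) (extChartAt I x) x u) := by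
    have := mvfderiv_comp_apply x (hL.contMDiffAt.mdifferentiableAt (by simp))
      (hc.mdifferentiableAt (by simp)) u
    rw [Function.comp_def] at this
    rw [this]
    simp [mvfderiv, mfderiv_eq_fderiv]
    rfl
  rw [h2, h2] at h1
  exact h1

/-- The Lie bracket of `F`-related vector fields. -/
theorem mfderiv_mlieBracket_of_related [CompleteSpace E] [CompleteSpace E'] {F : N → M} {p : N}
    {V W : (q : N) → TangentSpace I' q} {X Y : (x : M) → TangentSpace I x}
    (hF : CMDiffAt ∞ F p) (hV : CMDiffAt ∞ (T% V) p) (hW : CMDiffAt ∞ (T% W) p)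
    (hX : CMDiffAt ∞ (T% X) (F p)) (hY : CMDiffAt ∞ (T% Y) (F p))
    (hVX : ∀ q, mfderiv I' I F q (V q) = X (F q)) (hWY : ∀ q, mfderiv I' I F q (W q) = Y (F q)) :
    mfderiv I' I F p (mlieBracket I' V W p) = mlieBracket I X Y (F p) := by
  refine eq_of_mvfderiv_eq fun f hf ↦ ?_
  have hF1 : ∀ᶠ q in 𝓝 p, MDiffAt F q :=
    ((contMDiffAt_iff_contMDiffAt_nhds (by simp)).1 (hF.of_le (by simp : (1 : ℕ∞ω) ≤ ∞))).mono
      fun _ hy ↦ hy.mdifferentiableAt (by simp)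
  have hfF : CMDiffAt ∞ (f ∘ F) p := hf.comp p hF
  have comp {g : M → ℝ} {q : N} (hg : MDiffAt g (F q)) (hq : MDiffAt F q)
      (u : TangentSpace I' q) :
      mvfderiv I' (g ∘ F) q u = mvfderiv I g (F q) (mfderiv I' I F q u) :=
    mvfderiv_comp_apply q hg hq u
  have key {U : (q : N) → TangentSpace I' q} {Z : (x : M) → TangentSpace I x}
      (hUZ : ∀ q, mfderiv I' I F q (U q) = Z (F q)) :
      ∀ᶠ q in 𝓝 p, mvfderiv I' (f ∘ F) q (U q) = ((fun x ↦ mvfderiv I f x (Z x)) ∘ F) q := by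
    filter_upwards [hF1, hF.continuousAt.eventually (eventually_mdifferentiableAt hf)] with q h1 h2
    rw [comp h2 h1, hUZ]
    rfl
  have dY := (contMDiffAt_mvfderiv_apply hf hY).mdifferentiableAt (by simp)
  have dX := (contMDiffAt_mvfderiv_apply hf hX).mdifferentiableAt (by simp)
  have dF := hF.mdifferentiableAt (by simp)
  rw [← comp (hf.mdifferentiableAt (by simp)) dF, mvfderiv_mlieBracket hV hW hfF,
    mvfderiv_mlieBracket hX hY hf, mvfderiv_congr (key hVX), mvfderiv_congr (key hWY), comp dX dF,
    comp dY dF, hVX, hWY]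

end Related

/-! ### Brackets on M × ℝ. -/

section Product

variable {E : Type*} [NormedAddCommGroup E] [NormedSpace ℝ E]
  {M : Type*} [TopologicalSpace M] [ChartedSpace E M] [IsManifold 𝓘(ℝ, E) ∞ M]

/-- The vector field `X + a ∂/∂t` on `M × ℝ`. -/
def productField (X : (x : M) → TangentSpace 𝓘(ℝ, E) x) (a : ℝ) (p : M × ℝ) :
    TangentSpace (𝓘(ℝ, E).prod 𝓘(ℝ, ℝ)) p :=
  show E × ℝ from (X p.1, a)

variable {X Y : (x : M) → TangentSpace 𝓘(ℝ, E) x} {p : M × ℝ}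

theorem contMDiffAt_productField (hX : CMDiffAt ∞ (T% X) p.1) (a : ℝ) :
    CMDiffAt ∞ (T% (productField X a)) p := by
  have h1 : ContMDiffAt (𝓘(ℝ, E).prod 𝓘(ℝ, ℝ)) 𝓘(ℝ, E).tangent ∞
      (fun q : M × ℝ ↦ (⟨q.1, X q.1⟩ : TangentBundle 𝓘(ℝ, E) M)) p :=
    ContMDiffAt.comp (f := Prod.fst) (g := T% X) p hX contMDiffAt_fst
  have h2 : ContMDiffAt (𝓘(ℝ, E).prod 𝓘(ℝ, ℝ)) 𝓘(ℝ, ℝ).tangent ∞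
      (fun q : M × ℝ ↦ (⟨q.2, a⟩ : TangentBundle 𝓘(ℝ, ℝ) ℝ)) p := by
    refine contMDiffAt_totalSpace.2 ⟨contMDiffAt_snd, ?_⟩
    simp only [trivializationAt_model_space_apply]
    exact contMDiffAt_const
  exact ContMDiffAt.comp p contMDiff_equivTangentBundleProd_symm.contMDiffAt (h1.prodMk h2)

/-- The M-component follows since the fields are related to X and Y by the first projection. The
ℝ-component is the bracket applied to the coordinate t, whose derivatives along both fields are
constant. -/
theorem mlieBracket_productField [CompleteSpace E] (hX : CMDiffAt ∞ (T% X) p.1)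
    (hY : CMDiffAt ∞ (T% Y) p.1) (a b : ℝ) :
    mlieBracket (𝓘(ℝ, E).prod 𝓘(ℝ, ℝ)) (productField X a) (productField Y b) p
      = productField (mlieBracket 𝓘(ℝ, E) X Y) 0 p := by
  have h1 := mfderiv_mlieBracket_of_related (F := Prod.fst) contMDiffAt_fst
    (contMDiffAt_productField hX a) (contMDiffAt_productField hY b) hX hY
    (fun q ↦ by rw [mfderiv_fst]; rfl) (fun q ↦ by rw [mfderiv_fst]; rfl)
  have hs (X : (x : M) → TangentSpace 𝓘(ℝ, E) x) (a : ℝ) (q : M × ℝ) :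
      mvfderiv (𝓘(ℝ, E).prod 𝓘(ℝ, ℝ)) Prod.snd q (productField X a q) = a := by
    rw [mvfderiv, mfderiv_snd]; rfl
  have h2 := mvfderiv_mlieBracket (f := Prod.snd) (contMDiffAt_productField hX a)
    (contMDiffAt_productField hY b) contMDiffAt_snd
  simp only [hs, mvfderiv_const] at h2
  rw [mfderiv_fst] at h1
  rw [mvfderiv, mfderiv_snd] at h2
  exact Prod.ext h1 (h2.trans (sub_zero 0))

end Product

/-! ### The almost complex structure on M × ℝ and its Nijenhuis tensor. -/

section Cone

variable {E : Type*} [NormedAddCommGroup E] [NormedSpace ℝ E] [FiniteDimensional ℝ E]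
  {M : Type*} [TopologicalSpace M] [ChartedSpace E M] [IsManifold 𝓘(ℝ, E) ∞ M]
  [RiemannianBundle (fun x : M ↦ TangentSpace 𝓘(ℝ, E) x)]
  [IsContMDiffRiemannianBundle 𝓘(ℝ, E) ∞ E (fun x : M ↦ TangentSpace 𝓘(ℝ, E) x)]

namespace ContactMetricStructure₃

variable (S : ContactMetricStructure₃ E M) {p : M × ℝ}
  {X Y Z : (p : M × ℝ) → TangentSpace (𝓘(ℝ, E).prod 𝓘(ℝ, ℝ)) p}
  {e : (x : M) → TangentSpace 𝓘(ℝ, E) x}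

/-- The almost complex structure `J` as a linear map. -/
def coneJLinear (p : M × ℝ) : TangentSpace (𝓘(ℝ, E).prod 𝓘(ℝ, ℝ)) p →ₗ[ℝ]
    TangentSpace (𝓘(ℝ, E).prod 𝓘(ℝ, ℝ)) p where
  toFun := S.coneJ p
  map_add' v w := by
    have h₁ (u w : TangentSpace 𝓘(ℝ, E) p.1) (a b : ℝ) : S.φ p.1 (u + w) + (a + b) • S.ξ p.1
        = (S.φ p.1 u + a • S.ξ p.1) + (S.φ p.1 w + b • S.ξ p.1) := by
      rw [map_add]; module
    have h₂ (u w : TangentSpace 𝓘(ℝ, E) p.1) :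
        -S.η p.1 (u + w) = -S.η p.1 u + -S.η p.1 w := by
      rw [map_add]; ring
    exact Prod.ext (h₁ _ _ _ _) (h₂ _ _)
  map_smul' a v := by
    have h₁ (u : TangentSpace 𝓘(ℝ, E) p.1) (b : ℝ) :
        S.φ p.1 (a • u) + (a * b) • S.ξ p.1 = a • (S.φ p.1 u + b • S.ξ p.1) := by
      rw [map_smul]; module
    have h₂ (u : TangentSpace 𝓘(ℝ, E) p.1) : -S.η p.1 (a • u) = a * -S.η p.1 u := by
      rw [map_smul, smul_eq_mul]; ring
    exact Prod.ext (h₁ _ _) (h₂ _)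

theorem coneJ_add (v w : TangentSpace (𝓘(ℝ, E).prod 𝓘(ℝ, ℝ)) p) :
    S.coneJ p (v + w) = S.coneJ p v + S.coneJ p w := (S.coneJLinear p).map_add v w

theorem coneJ_smul (a : ℝ) (v : TangentSpace (𝓘(ℝ, E).prod 𝓘(ℝ, ℝ)) p) :
    S.coneJ p (a • v) = a • S.coneJ p v := (S.coneJLinear p).map_smul a v

theorem coneJ_neg (v : TangentSpace (𝓘(ℝ, E).prod 𝓘(ℝ, ℝ)) p) :
    S.coneJ p (-v) = -S.coneJ p v := (S.coneJLinear p).map_neg v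

theorem coneJ_zero (p : M × ℝ) : S.coneJ p 0 = 0 := (S.coneJLinear p).map_zero

theorem coneJ_coneJ (v : TangentSpace (𝓘(ℝ, E).prod 𝓘(ℝ, ℝ)) p) :
    S.coneJ p (S.coneJ p v) = -v := by
  have h₁ (u : TangentSpace 𝓘(ℝ, E) p.1) (a : ℝ) :
      S.φ p.1 (S.φ p.1 u + a • S.ξ p.1) + (-S.η p.1 u) • S.ξ p.1 = -u := by
    rw [map_add, map_smul, S.φ_ξ, S.φ_φ]
    module
  have h₂ (u : TangentSpace 𝓘(ℝ, E) p.1) (a : ℝ) :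
      -S.η p.1 (S.φ p.1 u + a • S.ξ p.1) = -a := by
    rw [map_add, map_smul, S.η_φ, S.η_ξ, smul_eq_mul]
    ring
  exact Prod.ext (h₁ _ _) (h₂ _ _)

theorem coneJ_productField (X : (x : M) → TangentSpace 𝓘(ℝ, E) x) (a : ℝ) (p : M × ℝ) :
    S.coneJ p (productField X a p) =
      productField (fun x ↦ S.φ x (X x) + a • S.ξ x) (-S.η p.1 (X p.1)) p := rfl

/-- Expand v in e, φe, ξ, ∂/∂t and apply J. This serves twice: it makes JX differentiable by writing
it with smooth fields, and it gives the spanning set used for the Nijenhuis tensor. -/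
theorem IsAdaptedAt.coneJ_eq_sum {S : ContactMetricStructure₃ E M}
    (hdim : Module.finrank ℝ E = 3) (he : S.IsAdaptedAt e p.1)
    (v : TangentSpace (𝓘(ℝ, E).prod 𝓘(ℝ, ℝ)) p) :
    S.coneJ p v =
      (inner ℝ (show TangentSpace 𝓘(ℝ, E) p.1 from v.1) (e p.1) : ℝ)
        • productField (fun x ↦ S.φ x (e x)) 0 p
      + (-inner ℝ (show TangentSpace 𝓘(ℝ, E) p.1 from v.1) (S.φ p.1 (e p.1)) : ℝ)
        • productField e 0 p
      + (show ℝ from v.2) • productField S.ξ 0 p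
      + (-inner ℝ (show TangentSpace 𝓘(ℝ, E) p.1 from v.1) (S.ξ p.1) : ℝ)
        • productField (0 : (x : M) → TangentSpace 𝓘(ℝ, E) x) 1 p := by
  have h₁ (u : TangentSpace 𝓘(ℝ, E) p.1) (a : ℝ) : S.φ p.1 u + a • S.ξ p.1
      = (inner ℝ u (e p.1) : ℝ) • S.φ p.1 (e p.1) + (-inner ℝ u (S.φ p.1 (e p.1)) : ℝ) • e p.1
        + a • S.ξ p.1 + (-inner ℝ u (S.ξ p.1) : ℝ) • (0 : TangentSpace 𝓘(ℝ, E) p.1) := by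
    have h := congrArg (S.φ p.1) (he.eq_sum hdim u)
    rw [map_add, map_add, map_smul, map_smul, map_smul, he.φ_φ, S.φ_ξ] at h
    rw [h]
    module
  have h₂ (u : TangentSpace 𝓘(ℝ, E) p.1) (a b c : ℝ) :
      -S.η p.1 u = a * 0 + b * 0 + c * 0 + -inner ℝ u (S.ξ p.1) * 1 := by
    rw [← S.inner_ξ]
    ring
  exact Prod.ext (h₁ _ _) (h₂ _ _ _ _)

theorem mdifferentiableAt_coneJ (hdim : Module.finrank ℝ E = 3) (hX : MDiffAt (T% X) p) :
    MDiffAt (T% (fun q ↦ S.coneJ q (X q))) p := by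
  obtain ⟨e, he⟩ := S.exists_isAdaptedAt hdim p.1
  have h := (contMDiff_equivTangentBundleProd (n := 1) (I := 𝓘(ℝ, E)) (M := M)
    (I' := 𝓘(ℝ, ℝ)) (M' := ℝ)).mdifferentiableAt (x := T% X p) (by simp) |>.comp p hX
  have h1 : MDifferentiableAt (𝓘(ℝ, E).prod 𝓘(ℝ, ℝ)) 𝓘(ℝ, E).tangent
      (fun q : M × ℝ ↦ (⟨q.1, (X q).1⟩ : TangentBundle 𝓘(ℝ, E) M)) p := h.fst
  have h2 : MDifferentiableAt (𝓘(ℝ, E).prod 𝓘(ℝ, ℝ)) 𝓘(ℝ, ℝ).tangent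
      (fun q : M × ℝ ↦ (⟨q.2, (X q).2⟩ : TangentBundle 𝓘(ℝ, ℝ) ℝ)) p := h.snd
  have h3 : MDiffAt (fun q : M × ℝ ↦ (show ℝ from (X q).2)) p := by
    have h4 := ((mdifferentiableAt_totalSpace _ _).1 h2).2
    simp only [trivializationAt_model_space_apply] at h4
    exact h4
  have hi {Z : (x : M) → TangentSpace 𝓘(ℝ, E) x} (hZ : CMDiffAt ∞ (T% Z) p.1) :
      MDiffAt (fun q : M × ℝ ↦
        (inner ℝ (show TangentSpace 𝓘(ℝ, E) q.1 from (X q).1) (Z q.1) : ℝ)) p :=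
    MDifferentiableAt.inner_bundle (IB := 𝓘(ℝ, E)) (F := E)
      (E := fun x : M ↦ TangentSpace 𝓘(ℝ, E) x) (b := Prod.fst)
      (v := fun q ↦ (X q).1) (w := fun q ↦ Z q.1) h1
      ((hZ.mdifferentiableAt (by simp)).comp (f := Prod.fst) p mdifferentiableAt_fst)
  have hp {Z : (x : M) → TangentSpace 𝓘(ℝ, E) x} (hZ : CMDiffAt ∞ (T% Z) p.1) (a : ℝ) :=
    (contMDiffAt_productField hZ a).mdifferentiableAt (by simp)
  have hξ : CMDiffAt ∞ (T% S.ξ) p.1 := S.contMDiff_ξ.contMDiffAt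
  have h0 : CMDiffAt ∞ (T% (0 : (x : M) → TangentSpace 𝓘(ℝ, E) x)) p.1 :=
    (contMDiff_zeroSection ℝ _).contMDiffAt
  have key := mdifferentiableAt_add_section (mdifferentiableAt_add_section
    (mdifferentiableAt_add_section ((hi he.contMDiffAt).smul_section (hp he.contMDiffAt_φ 0))
    ((hi he.contMDiffAt_φ).neg.smul_section (hp he.contMDiffAt 0)))
    (h3.smul_section (hp hξ 0))) ((hi hξ).neg.smul_section (hp h0 1))
  refine key.congr_of_eventuallyEq ?_
  filter_upwards [continuousAt_fst.eventually he.eventually] with q hq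
  rw [hq.coneJ_eq_sum hdim]
  rfl

theorem coneNijenhuis_swap (X Y : (p : M × ℝ) → TangentSpace (𝓘(ℝ, E).prod 𝓘(ℝ, ℝ)) p)
    (p : M × ℝ) : S.coneNijenhuis X Y p = -S.coneNijenhuis Y X p := by
  simp only [coneNijenhuis]
  rw [mlieBracket_swap_apply (V := fun q ↦ S.coneJ q (X q)) (W := fun q ↦ S.coneJ q (Y q)),
    mlieBracket_swap_apply (V := fun q ↦ S.coneJ q (X q)) (W := Y),
    mlieBracket_swap_apply (V := X) (W := fun q ↦ S.coneJ q (Y q)),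
    mlieBracket_swap_apply (V := X) (W := Y), S.coneJ_neg, S.coneJ_neg]
  abel

/-- The derivatives of f along Y and along JY each occur twice, and cancel because J² = -1. -/
theorem tensorialAt_coneNijenhuis_left (hdim : Module.finrank ℝ E = 3) (Y)  :
    TensorialAt (𝓘(ℝ, E).prod 𝓘(ℝ, ℝ)) (E × ℝ) (fun X ↦ S.coneNijenhuis X Y p) p where
  smul {f X} hf hX := by
    have hJX := S.mdifferentiableAt_coneJ hdim hX
    have h : (fun q ↦ S.coneJ q ((f • X) q)) = f • fun q ↦ S.coneJ q (X q) := by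
      funext q
      exact S.coneJ_smul _ _
    simp only [coneNijenhuis, h, mlieBracket_smul_left hf hX, mlieBracket_smul_left hf hJX,
      S.coneJ_add, S.coneJ_smul, S.coneJ_coneJ]
    module
  add {X X'} hX hX' := by
    have hJX := S.mdifferentiableAt_coneJ hdim hX
    have hJX' := S.mdifferentiableAt_coneJ hdim hX'
    have h : (fun q ↦ S.coneJ q ((X + X') q))
        = (fun q ↦ S.coneJ q (X q)) + fun q ↦ S.coneJ q (X' q) := by
      funext q
      exact S.coneJ_add _ _
    simp only [coneNijenhuis, h, mlieBracket_add_left hX hX', mlieBracket_add_left hJX hJX',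
      S.coneJ_add]
    abel

theorem tensorialAt_coneNijenhuis_right (hdim : Module.finrank ℝ E = 3) (X) :
    TensorialAt (𝓘(ℝ, E).prod 𝓘(ℝ, ℝ)) (E × ℝ) (fun Y ↦ S.coneNijenhuis X Y p) p where
  smul hf hY := by
    simp only [S.coneNijenhuis_swap X]
    rw [(S.tensorialAt_coneNijenhuis_left hdim X).smul hf hY, smul_neg]
  add hY hY' := by
    simp only [S.coneNijenhuis_swap X]
    rw [(S.tensorialAt_coneNijenhuis_left hdim X).add hY hY', neg_add]

theorem coneNijenhuis_coneJ_left (hX : MDiffAt (T% X) p) :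
    S.coneNijenhuis (fun q ↦ S.coneJ q (X q)) Y p = -S.coneJ p (S.coneNijenhuis X Y p) := by
  have h : (fun q ↦ S.coneJ q (S.coneJ q (X q))) = (-1 : ℝ) • X := by
    funext q
    rw [S.coneJ_coneJ]
    simp
  rw [coneNijenhuis, coneNijenhuis, h, mlieBracket_const_smul_left hX,
    mlieBracket_const_smul_left hX]
  simp only [sub_eq_add_neg, S.coneJ_add, S.coneJ_neg, S.coneJ_coneJ, S.coneJ_smul]
  module

/-- The Nijenhuis tensor vanishes at `p` if `N(e, ∂/∂t) = 0`. -/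
theorem IsAdaptedAt.coneNijenhuis_eq_zero {S : ContactMetricStructure₃ E M}
    (hdim : Module.finrank ℝ E = 3) (he : S.IsAdaptedAt e p.1)
    (h : S.coneNijenhuis (productField e 0) (productField 0 1) p = 0)
    (hX : MDiffAt (T% X) p) (hY : MDiffAt (T% Y) p) : S.coneNijenhuis X Y p = 0 := by
  let B := TensorialAt.mkHom₂ (S.coneNijenhuis · · p) p
    (fun Y _ ↦ S.tensorialAt_coneNijenhuis_left hdim Y)
    (fun X _ ↦ S.tensorialAt_coneNijenhuis_right hdim X)
  have hB {X Y : (p : M × ℝ) → TangentSpace (𝓘(ℝ, E).prod 𝓘(ℝ, ℝ)) p} (hX : MDiffAt (T% X) p)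
      (hY : MDiffAt (T% Y) p) : B (X p) (Y p) = S.coneNijenhuis X Y p :=
    TensorialAt.mkHom₂_apply _ _ hX hY
  have hext (u : TangentSpace (𝓘(ℝ, E).prod 𝓘(ℝ, ℝ)) p) :=
    FiberBundle.mdifferentiableAt_extend (𝓘(ℝ, E).prod 𝓘(ℝ, ℝ)) (E × ℝ) u
  have swap (u v) : B u v = -B v u := by
    have h1 := hB (hext u) (hext v)
    have h2 := hB (hext v) (hext u)
    simp only [FiberBundle.extend_apply_self] at h1 h2
    rw [h1, h2, S.coneNijenhuis_swap]
  have left (u v) : B (S.coneJ p u) v = -S.coneJ p (B u v) := by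
    have h1 := hB (hext u) (hext v)
    have h2 := hB (S.mdifferentiableAt_coneJ hdim (hext u)) (hext v)
    rw [S.coneNijenhuis_coneJ_left (hext u), ← h1] at h2
    simpa only [FiberBundle.extend_apply_self] using h2
  have right (u v) : B u (S.coneJ p v) = -S.coneJ p (B u v) := by
    rw [swap, left, swap u v, S.coneJ_neg]
  have self (u) : B u u = 0 := by
    have h := swap u u
    rw [eq_neg_iff_add_eq_zero, ← two_smul ℝ] at h
    exact (smul_eq_zero.1 h).resolve_left two_ne_zero
  have h0 : CMDiffAt ∞ (T% (0 : (x : M) → TangentSpace 𝓘(ℝ, E) x)) p.1 :=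
    (contMDiff_zeroSection ℝ _).contMDiffAt
  set a : TangentSpace (𝓘(ℝ, E).prod 𝓘(ℝ, ℝ)) p := productField e 0 p
  set t : TangentSpace (𝓘(ℝ, E).prod 𝓘(ℝ, ℝ)) p :=
    productField (0 : (x : M) → TangentSpace 𝓘(ℝ, E) x) 1 p
  have hat : B a t = 0 := by
    rw [← h]
    exact hB ((contMDiffAt_productField he.contMDiffAt 0).mdifferentiableAt (by simp))
      ((contMDiffAt_productField h0 1).mdifferentiableAt (by simp))
  have hta : B t a = 0 := by rw [swap, hat, neg_zero]
  have ha : productField (fun x ↦ S.φ x (e x)) 0 p = S.coneJ p a := by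
    rw [S.coneJ_productField, he.η_apply]
    refine Prod.ext ?_ ?_
    · change S.φ p.1 (e p.1) = S.φ p.1 (e p.1) + (0 : ℝ) • S.ξ p.1
      module
    · exact neg_zero.symm
  have ht : productField S.ξ 0 p = S.coneJ p t := by
    rw [S.coneJ_productField]
    refine Prod.ext ?_ ?_
    · change S.ξ p.1 = S.φ p.1 0 + (1 : ℝ) • S.ξ p.1
      rw [map_zero]
      module
    · change (0 : ℝ) = -S.η p.1 0
      rw [map_zero, neg_zero]
  -- Expanding J(Ju) = -u by `coneJ_eq_sum` supplies the coefficients up to sign.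
  have span (u) : ∃ c₁ c₂ c₃ c₄ : ℝ,
      u = c₁ • a + c₂ • S.coneJ p a + c₃ • t + c₄ • S.coneJ p t := by
    have h := he.coneJ_eq_sum hdim (S.coneJ p u)
    rw [S.coneJ_coneJ, ha, ht] at h
    obtain ⟨α, β, γ, δ, h⟩ : ∃ α β γ δ : ℝ,
        -u = α • S.coneJ p a + β • a + γ • S.coneJ p t + δ • t := ⟨_, _, _, _, h⟩
    refine ⟨-β, -α, -δ, -γ, ?_⟩
    rw [← neg_neg u, h]
    module
  rw [← hB hX hY]
  obtain ⟨c₁, c₂, c₃, c₄, hu⟩ := span (X p)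
  obtain ⟨d₁, d₂, d₃, d₄, hv⟩ := span (Y p)
  rw [hu, hv]
  -- By antilinearity J can be pulled out of both slots, so every entry reduces to B(a,a), B(t,t),
  -- B(a,t) or B(t,a), all zero.
  simp only [map_add, map_smul, add_apply, smul_apply, left, right, self, hat, hta,
    S.coneJ_zero, neg_zero, smul_zero, add_zero]

/-- The Killing equation on (e,e) and on (e,φe) annihilates precisely the two coefficients in
`h_self`, since g(e,e) and g(e,φe) are constant near x. -/
theorem IsAdaptedAt.h_eq_zero {S : ContactMetricStructure₃ E M} {x : M}
    (hdim : Module.finrank ℝ E = 3) (hK : S.IsKContact) (he : S.IsAdaptedAt e x) :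
    S.h x (e x) = 0 := by
  have d := he.contMDiffAt.mdifferentiableAt (by simp)
  have d' := he.contMDiffAt_φ.mdifferentiableAt (by simp)
  have h1 := hK x _ _ d d
  have h2 := hK x _ _ d d'
  rw [mvfderiv_eq_zero_of_eventually_const (he.eventually.mono fun y hy ↦ hy.inner_self),
    real_inner_comm _ (e x)] at h1
  rw [mvfderiv_eq_zero_of_eventually_const (c := 0) (.of_forall fun y ↦ inner_φ _),
    real_inner_comm _ (e x)] at h2
  rw [he.h_self hdim]
  have h3 : inner ℝ (mlieBracket 𝓘(ℝ, E) S.ξ e x) (e x) = 0 := by linarith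
  have h4 : (inner ℝ (mlieBracket 𝓘(ℝ, E) S.ξ (fun y ↦ S.φ y (e y)) x) (e x)
        + inner ℝ (mlieBracket 𝓘(ℝ, E) S.ξ e x) (S.φ x (e x))) / 2 = 0 := by linarith
  rw [h3, h4]
  module

/-- With Je = φe and J(∂/∂t) = ξ, the brackets with ∂/∂t vanish and N(e, ∂/∂t) = [φe,ξ] - J[e,ξ].
Its M-component is -2he, and its ∂/∂t-component is η([e,ξ]) = 0. -/
theorem IsAdaptedAt.coneNijenhuis_productField {S : ContactMetricStructure₃ E M}
    (he : S.IsAdaptedAt e p.1) (h : S.h p.1 (e p.1) = 0) :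
    S.coneNijenhuis (productField e 0) (productField 0 1) p = 0 := by
  have hξ : CMDiffAt ∞ (T% S.ξ) p.1 := S.contMDiff_ξ.contMDiffAt
  have h0 : CMDiffAt ∞ (T% (0 : (x : M) → TangentSpace 𝓘(ℝ, E) x)) p.1 :=
    (contMDiff_zeroSection ℝ _).contMDiffAt
  have h1 : ∀ᶠ q in 𝓝 p, S.coneJ q (productField e 0 q)
      = productField (fun x ↦ S.φ x (e x)) 0 q := by
    filter_upwards [continuousAt_fst.eventually he.eventually] with q hq
    rw [S.coneJ_productField, hq.η_apply]
    refine Prod.ext ?_ ?_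
    · change S.φ q.1 (e q.1) + (0 : ℝ) • S.ξ q.1 = S.φ q.1 (e q.1)
      module
    · exact neg_zero
  have h2 : ∀ᶠ q in 𝓝 p, S.coneJ q (productField 0 1 q) = productField S.ξ 0 q := by
    refine .of_forall fun q ↦ ?_
    rw [S.coneJ_productField]
    refine Prod.ext ?_ ?_
    · change S.φ q.1 0 + (1 : ℝ) • S.ξ q.1 = S.ξ q.1
      rw [map_zero]
      module
    · change -S.η q.1 0 = (0 : ℝ)
      rw [map_zero, neg_zero]
  have h3 : productField (0 : (x : M) → TangentSpace 𝓘(ℝ, E) x) 0 p = 0 := rfl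
  rw [S.h_apply he.contMDiffAt, smul_eq_zero_iff_right (by norm_num), lieDerivEndo,
    sub_eq_zero] at h
  rw [coneNijenhuis, mlieBracket_congr h1 h2, mlieBracket_congr h1 (.of_forall fun _ ↦ rfl),
    mlieBracket_congr (.of_forall fun _ ↦ rfl) h2, mlieBracket_productField he.contMDiffAt_φ hξ,
    mlieBracket_productField he.contMDiffAt_φ h0, mlieBracket_productField he.contMDiffAt hξ,
    mlieBracket_productField he.contMDiffAt h0, mlieBracket_zero_right, mlieBracket_zero_right, h3,
    S.coneJ_zero, S.coneJ_productField, sub_zero, sub_zero]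
  rw [mlieBracket_swap (V := e), mlieBracket_swap (W := S.ξ)]
  refine Prod.ext ?_ ?_
  · change -mlieBracket 𝓘(ℝ, E) S.ξ (fun x ↦ S.φ x (e x)) p.1
      - (S.φ p.1 (-mlieBracket 𝓘(ℝ, E) S.ξ e p.1) + (0 : ℝ) • S.ξ p.1) = 0
    rw [h, map_neg]
    module
  · change (0 : ℝ) - -S.η p.1 (-mlieBracket 𝓘(ℝ, E) S.ξ e p.1) = 0
    rw [map_neg, he.η_mlieBracket_ξ_self]
    ring

theorem IsKContact.isSasakian {S : ContactMetricStructure₃ E M}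
    (hdim : Module.finrank ℝ E = 3) (hK : S.IsKContact) : S.IsSasakian := by
  intro p X Y hX hY
  obtain ⟨e, he⟩ := S.exists_isAdaptedAt hdim p.1
  exact he.coneNijenhuis_eq_zero hdim
    (he.coneNijenhuis_productField (he.h_eq_zero hdim hK)) hX hY

end ContactMetricStructure₃

end Cone

end ContactGeometry

end

theorem mainTheorem7
    {E : Type*} [NormedAddCommGroup E] [NormedSpace ℝ E] [FiniteDimensional ℝ E]
    (hdim : Module.finrank ℝ E = 3)
    {M : Type*} [TopologicalSpace M] [T2Space M] [ChartedSpace E M] [IsManifold 𝓘(ℝ, E) ∞ M]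
    [RiemannianBundle (fun x : M ↦ TangentSpace 𝓘(ℝ, E) x)]
    [IsContMDiffRiemannianBundle 𝓘(ℝ, E) ∞ E (fun x : M ↦ TangentSpace 𝓘(ℝ, E) x)]
    (S : ContactGeometry.ContactMetricStructure₃ E M) :
    (∀ x : M, S.starScalarCurvature x - ContactGeometry.scalarCurvature E x + 4
        = 2 * S.traceHSq x) ∧
      (S.IsKContact → S.IsSasakian) := by
  refine ⟨fun x ↦ ?_, fun hK ↦ hK.isSasakian hdim⟩
  obtain ⟨e, he⟩ := S.exists_isAdaptedAt hdim x
  exact he.starScalarCurvature_sub_scalarCurvature hdim
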